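/- **Definitions.** A *measurement scenario* $\mathbf X=\langle X,\Sigma,O\rangle$ consists of a finite set $X$ of measurements, a finite non-empty outcome set $O_x$ for each $x\in X$, and a simplicial complex $\Sigma$ on $X$ (a downwards closed set of subsets containing $\emptyset$ and all singletons; its elements are the contexts). For $U\subseteq X$ put $\mathcal E(U)=\prod_{x\in U}O_x$. A *deterministic morphism* $\langle\pi,h\rangle:\langle Y,\Theta,P\rangle\to\langle X,\Sigma,O\rangle$ is a map $\pi:X\to Y$ with $\pi(\sigma)\in\Theta$ for all $\sigma\in\Sigma$, together with maps $h_x:P_{\pi(x)}\to O_x$ for $x\in X$; morphisms are composed componentwise. An *empirical model* $e$ on $\mathbf X$ is a family of probability distributions $e_\sigma$ on $\mathcal E(\sigma)$, $\sigma\in\Sigma$, such that $e_\tau$ is the marginal of $e_\sigma$ whenever $\tau\subseteq\sigma$. The pushforward $\langle\pi,h\rangle_*d$ of a model $d$ has as its distribution at $\sigma$ the image of $d_{\pi(\sigma)}$ under $h$. The category $\mathsf{Emp}$ has the empirical models as objects and as morphisms $d\to e$ (*deterministic simulations*) the deterministic morphisms $f$ of the underlying scenarios with $e=f_*d$. Scenarios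 and $\mathsf{Emp}$ are monoidal: $\mathbf X\otimes\mathbf Y$ has the disjoint union of measurements (with their outcomes) and the contexts $\sigma\sqcup\tau$ with $\sigma$, $\tau$ contexts of $\mathbf X$, $\mathbf Y$; $(e\otimes d)_{\sigma\sqcup\tau}$ is the product distribution of $e_\sigma$ and $d_\tau$; the unit is the scenario without measurements, with its unique model. A *run* on $\mathbf X$ is a sequence $\bar x=(x_i,o_i)_{i=1}^n$ with distinct $x_i$, $\sigma_{\bar x}=\{x_1,\dots,x_n\}\in\Sigma$ and $o_i\in O_{x_i}$; $s_{\bar x}$ denotes the assignment $x_i\mapsto o_i$. Runs are *consistent* if they agree on common measurements. A *measurement protocol* is a non-empty set $Q$ of runs that is closed under prefixes and such that $\bar x\cdot(x,o)\in Q$ implies $\bar x\cdot(x,o')\in Q$ for all $o'\in O_x$, and $\bar x\cdot(x,o),\ \bar x\cdot(x',o')\in Q$ implies $x=x'$. The scenario $\mathsf{MP}(\mathbf X)$ has the measurement protocols on $\mathbf X$ as measurements; the outcomes of $Q$ are its maximal runs; a set $\{Q_1,\dots,Q_n\}$ is a context if $\bigcup_i\sigma_{\bar x_i}\in\Sigma$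 for all pairwise consistent runs $\bar x_i\in Q_i$. For a model $e$ on $\mathbf X$, $\mathsf{MP}(e)$ gives to the joint outcome $Q_i\mapsto\bar x_i$ of a context $\{Q_1,\dots,Q_n\}$ the probability $e_{\bigcup_i\sigma_{\bar x_i}}\bigl(\bigcup_i s_{\bar x_i}\bigr)$ if the $\bar x_i$ are pairwise consistent, and $0$ otherwise. *Counit.* $\epsilon_{\mathbf X}:\mathsf{MP}(\mathbf X)\to\mathbf X$ sends a measurement $x$ to the protocol $\{\Lambda\}\cup\{(x,o):o\in O_x\}$ ($\Lambda$ the empty word) and its outcome $(x,o)$ to $o$. *Extension.* For consistent runs the merge $\bar x*\bar y$ appends to $\bar x$, in order, the entries of $\bar y$ whose measurement has not occurred before. For $f=\langle\pi,h\rangle:\mathsf{MP}(\mathbf X)\to\mathbf Y$ and a run $\bar y=(y_i,p_i)_{i=1}^n$ on $\mathbf Y$, say that $\bar x_1*\cdots*\bar x_n$ *interprets* $\bar y$ if the $\bar x_i$ are pairwise consistent maximal runs of $\pi(y_i)$ with $h_{y_i}(\bar x_i)=p_i$. Then $f^\dagger=\langle\pi^\dagger,h^\dagger\rangle:\mathsf{MP}(\mathbf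 X)\to\mathsf{MP}(\mathbf Y)$ is given by: $\pi^\dagger(Q)$ is the set of prefixes of words that interpret some $\bar y\in Q$, and $h^\dagger_Q$ sends a maximal run of $\pi^\dagger(Q)$ to the maximal run of $Q$ that it interprets. *Comonoidal map.* $m_{\mathbf X,\mathbf Y}:\mathsf{MP}(\mathbf X\otimes\mathbf Y)\to\mathsf{MP}(\mathbf X)\otimes\mathsf{MP}(\mathbf Y)$ sends a protocol on $\mathbf X$ (or on $\mathbf Y$) to the same protocol seen as a protocol on $\mathbf X\otimes\mathbf Y$, and its maximal runs to the corresponding ones. **Theorem.** 1. For every $f:\mathsf{MP}(\mathbf X)\to\mathbf Y$ the above description defines one and only one deterministic morphism $f^\dagger:\mathsf{MP}(\mathbf X)\to\mathsf{MP}(\mathbf Y)$, and $(\mathsf{MP},\epsilon,(-)^\dagger)$ is a co-Kleisli triple on the category of measurement scenarios: $\epsilon_{\mathbf X}^\dagger=\mathrm{id}$, $\epsilon_{\mathbf Y}\circ f^\dagger=f$ and $(g\circ f^\dagger)^\dagger=g^\dagger\circ f^\dagger$. Hence $\mathsf{MP}$ is a comonad on that category. 2. This comonad is comonoidal with respect to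 $\otimes$: the maps $m_{\mathbf X,\mathbf Y}$, together with a map from $\mathsf{MP}$ of the unit to the unit, make $\mathsf{MP}$ an oplax monoidal functor for which the counit and the comultiplication are monoidal natural transformations. 3. For every empirical model $e$ on $\mathbf X$, $\mathsf{MP}(e)$ is an empirical model on $\mathsf{MP}(\mathbf X)$, and $\mathsf{MP}$ lifts to a comonoidal comonad on $\mathsf{Emp}$: there is a co-Kleisli triple on $\mathsf{Emp}$ with object map $e\mapsto\mathsf{MP}(e)$, whose comonad is comonoidal, and whose counit, extension operator and comonoidal maps have those of parts 1 and 2 as their underlying deterministic morphisms. -/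

import Mathlib

open CategoryTheory MonoidalCategory

universe u v w

/-! ### Measurement scenarios and deterministic morphisms -/

/-- A measurement scenario `⟨X, Σ, O⟩`: a finite set `Meas` of measurements, a finite non-empty set
`Out x` of outcomes for each measurement, and a simplicial complex `faces` on `Meas` (a non-empty,
downwards closed set of subsets, the empty set included, that contains all the singletons), whose
faces are the measurement contexts. -/
structure Scenario : Type (u + 1) where
  Meas : Type u
  Out : Meas → Type u
  faces : Set (Set Meas)
  finite_meas : Finite Meas
  finite_out : ∀ x, Finite (Out x)
  nonempty_out : ∀ x, Nonempty (Out x)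
  empty_mem : ∅ ∈ faces
  down_closed : ∀ σ ∈ faces, ∀ τ, τ ⊆ σ → τ ∈ faces
  singleton_mem : ∀ x, {x} ∈ faces

namespace Scenario

attribute [instance] finite_meas finite_out nonempty_out

/-- The set `ℰ(U) = ∏_{x ∈ U} O_x` of joint outcomes for a set `U` of measurements. -/
abbrev Sections (X : Scenario.{u}) (U : Set X.Meas) : Type u := ∀ x : U, X.Out x

/-- The restriction map `ℰ(V) → ℰ(U)` of the event sheaf, for `U ⊆ V`. -/
def restrict (X : Scenario.{u}) {U V : Set X.Meas} (h : U ⊆ V) (s : X.Sections V) :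
    X.Sections U := fun x => s ⟨x, h x.2⟩

/-- A deterministic morphism `⟨π, h⟩ : Y → X`: a simplicial map `π` from the complex of `X` to the
complex of `Y` (mind the direction), and for each measurement `x` of `X` a map `h_x` from the
outcomes of `π x` to those of `x`. -/
structure Hom (Y X : Scenario.{u}) : Type u where
  onMeas : X.Meas → Y.Meas
  onOut : ∀ x, Y.Out (onMeas x) → X.Out x
  simplicial : ∀ σ ∈ X.faces, onMeas '' σ ∈ Y.faces

/-- Measurement scenarios and deterministic morphisms form a category. -/
instance : Category.{u} Scenario.{u} where
  Hom Y X := Hom Y X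
  id X := ⟨id, fun _ => id, fun σ hσ => by simpa using hσ⟩
  comp f g := ⟨f.onMeas ∘ g.onMeas, fun x => g.onOut x ∘ f.onOut (g.onMeas x), fun σ hσ => by
    rw [Set.image_comp]; exact f.simplicial _ (g.simplicial _ hσ)⟩

theorem hom_ext {Y X : Scenario.{u}} {f g : Y ⟶ X} (h : ∀ x, f.onMeas x = g.onMeas x)
    (h' : ∀ x o, f.onOut x o = g.onOut x (cast (congrArg Y.Out (h x)) o)) : f = g := by
  obtain ⟨f, f', hf⟩ := f
  obtain ⟨g, g', hg⟩ := g
  obtain rfl : f = g := funext h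
  obtain rfl : f' = g' := funext fun x => funext fun o => h' x o
  rfl

/-! ### The monoidal structure on scenarios -/

/-- The scenario with no measurements, whose only context is `∅`. -/
abbrev unit : Scenario.{u} where
  Meas := PEmpty
  Out := PEmpty.elim
  faces := Set.univ
  finite_meas := inferInstance
  finite_out x := x.elim
  nonempty_out x := x.elim
  empty_mem := trivial
  down_closed _ _ _ _ := trivial
  singleton_mem x := x.elim

/-- The tensor product `X ⊗ Y`: measurements and outcomes are given by the disjoint union, and the
contexts form the simplicial join, i.e. they are the sets `σ ⊔ τ` with `σ` a context of `X` and `τ`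
a context of `Y`. -/
abbrev tensor (X Y : Scenario.{u}) : Scenario.{u} where
  Meas := X.Meas ⊕ Y.Meas
  Out := Sum.elim X.Out Y.Out
  faces := {ρ | Sum.inl ⁻¹' ρ ∈ X.faces ∧ Sum.inr ⁻¹' ρ ∈ Y.faces}
  finite_meas := inferInstance
  finite_out := by rintro (x | y); exacts [X.finite_out x, Y.finite_out y]
  nonempty_out := by rintro (x | y); exacts [X.nonempty_out x, Y.nonempty_out y]
  empty_mem := ⟨X.empty_mem, Y.empty_mem⟩
  down_closed := fun σ hσ τ h => ⟨X.down_closed _ hσ.1 _ (Set.preimage_mono h),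
    Y.down_closed _ hσ.2 _ (Set.preimage_mono h)⟩
  singleton_mem := by
    rintro (x | y)
    · exact ⟨X.down_closed _ (X.singleton_mem x) _ (fun z hz => by simpa using hz),
        Y.down_closed _ Y.empty_mem _ (fun z hz => by simp at hz)⟩
    · exact ⟨X.down_closed _ X.empty_mem _ (fun z hz => by simp at hz),
        Y.down_closed _ (Y.singleton_mem y) _ (fun z hz => by simpa using hz)⟩

/-- The action of the tensor product on deterministic morphisms, componentwise. -/
def tensorMap {X X' Y Y' : Scenario.{u}} (f : X ⟶ X') (g : Y ⟶ Y') : tensor X Y ⟶ tensor X' Y' where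
  onMeas := Sum.map f.onMeas g.onMeas
  onOut := Sum.rec f.onOut g.onOut
  simplicial := by
    rintro σ ⟨h1, h2⟩
    refine ⟨X.down_closed _ (f.simplicial _ h1) _ ?_, Y.down_closed _ (g.simplicial _ h2) _ ?_⟩
    · rintro x ⟨a | b, ha, h⟩
      · exact ⟨a, ha, Sum.inl.inj h⟩
      · cases h
    · rintro x ⟨a | b, ha, h⟩
      · cases h
      · exact ⟨b, ha, Sum.inr.inj h⟩

/-- `(X ⊗ Y) ⊗ Z → X ⊗ (Y ⊗ Z)`, re-bracketing the disjoint union. -/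
def assocHom (X Y Z : Scenario.{u}) : tensor (tensor X Y) Z ⟶ tensor X (tensor Y Z) where
  onMeas := Sum.elim (Sum.inl ∘ Sum.inl) (Sum.elim (Sum.inl ∘ Sum.inr) Sum.inr)
  onOut := Sum.rec (fun _ o => o) (Sum.rec (fun _ o => o) (fun _ o => o))
  simplicial := by
    rintro σ ⟨h1, h2, h3⟩
    refine ⟨⟨X.down_closed _ h1 _ ?_, Y.down_closed _ h2 _ ?_⟩, Z.down_closed _ h3 _ ?_⟩ <;>
    · rintro x ⟨a | b | c, ha, h⟩ <;> cases h <;> exact ha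

/-- `X ⊗ (Y ⊗ Z) → (X ⊗ Y) ⊗ Z`, re-bracketing the disjoint union. -/
def assocInv (X Y Z : Scenario.{u}) : tensor X (tensor Y Z) ⟶ tensor (tensor X Y) Z where
  onMeas := Sum.elim (Sum.elim Sum.inl (Sum.inr ∘ Sum.inl)) (Sum.inr ∘ Sum.inr)
  onOut := Sum.rec (Sum.rec (fun _ o => o) (fun _ o => o)) (fun _ o => o)
  simplicial := by
    rintro σ ⟨⟨h1, h2⟩, h3⟩
    refine ⟨X.down_closed _ h1 _ ?_, Y.down_closed _ h2 _ ?_, Z.down_closed _ h3 _ ?_⟩ <;>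
    · rintro x ⟨(a | b) | c, ha, h⟩ <;> cases h <;> exact ha

/-- `I ⊗ X → X`. -/
def leftUnitHom (X : Scenario.{u}) : tensor unit X ⟶ X where
  onMeas := Sum.inr
  onOut _ o := o
  simplicial σ hσ := ⟨trivial, X.down_closed _ hσ _ (by rintro x ⟨a, ha, h⟩; cases h; exact ha)⟩

/-- `X → I ⊗ X`. -/
def leftUnitInv (X : Scenario.{u}) : X ⟶ tensor unit X where
  onMeas := Sum.elim PEmpty.elim id
  onOut := Sum.rec (fun x => x.elim) (fun _ o => o)
  simplicial σ hσ := X.down_closed _ hσ.2 _ (by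
    rintro x ⟨a | a, ha, h⟩
    · exact a.elim
    · cases h; exact ha)

/-- `X ⊗ I → X`. -/
def rightUnitHom (X : Scenario.{u}) : tensor X unit ⟶ X where
  onMeas := Sum.inl
  onOut _ o := o
  simplicial σ hσ := ⟨X.down_closed _ hσ _ (by rintro x ⟨a, ha, h⟩; cases h; exact ha), trivial⟩

/-- `X → X ⊗ I`. -/
def rightUnitInv (X : Scenario.{u}) : X ⟶ tensor X unit where
  onMeas := Sum.elim id PEmpty.elim
  onOut := Sum.rec (fun _ o => o) (fun x => x.elim)
  simplicial σ hσ := X.down_closed _ hσ.1 _ (by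
    rintro x ⟨a | a, ha, h⟩
    · cases h; exact ha
    · exact a.elim)

instance : MonoidalCategoryStruct Scenario.{u} where
  tensorObj := tensor
  tensorHom f g := tensorMap f g
  whiskerLeft X _ _ g := tensorMap (𝟙 X) g
  whiskerRight f Y := tensorMap f (𝟙 Y)
  tensorUnit := unit
  associator X Y Z :=
    { hom := assocHom X Y Z
      inv := assocInv X Y Z
      hom_inv_id := hom_ext (by rintro ((_ | _) | _) <;> rfl) (by rintro ((_ | _) | _) _ <;> rfl)
      inv_hom_id := hom_ext (by rintro (_ | _ | _) <;> rfl) (by rintro (_ | _ | _) _ <;> rfl) }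
  leftUnitor X :=
    { hom := leftUnitHom X
      inv := leftUnitInv X
      hom_inv_id := hom_ext (by rintro (⟨⟨⟩⟩ | _); rfl) (by rintro (⟨⟨⟩⟩ | _) _; rfl)
      inv_hom_id := hom_ext (fun _ => rfl) (fun _ _ => rfl) }
  rightUnitor X :=
    { hom := rightUnitHom X
      inv := rightUnitInv X
      hom_inv_id := hom_ext (by rintro (_ | ⟨⟨⟩⟩); rfl) (by rintro (_ | ⟨⟨⟩⟩) _; rfl)
      inv_hom_id := hom_ext (fun _ => rfl) (fun _ _ => rfl) }

/-- The tensor product makes the category of measurement scenarios monoidal. -/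
instance : MonoidalCategory Scenario.{u} :=
  MonoidalCategory.ofTensorHom
    (id_tensorHom_id := fun X Y => hom_ext (by rintro (_ | _) <;> rfl) (by rintro (_ | _) _ <;> rfl))
    (id_tensorHom := fun _ _ _ _ => rfl)
    (tensorHom_id := fun _ _ => rfl)
    (tensorHom_comp_tensorHom := fun _ _ _ _ =>
      hom_ext (by rintro (_ | _) <;> rfl) (by rintro (_ | _) _ <;> rfl))
    (associator_naturality := fun _ _ _ =>
      hom_ext (by rintro (_ | _ | _) <;> rfl) (by rintro (_ | _ | _) _ <;> rfl))
    (leftUnitor_naturality := fun _ => hom_ext (fun _ => rfl) (fun _ _ => rfl))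
    (rightUnitor_naturality := fun _ => hom_ext (fun _ => rfl) (fun _ _ => rfl))
    (pentagon := fun _ _ _ _ =>
      hom_ext (by rintro (_ | _ | _ | _) <;> rfl) (by rintro (_ | _ | _ | _) _ <;> rfl))
    (triangle := fun _ _ =>
      hom_ext (by rintro (_ | _) <;> rfl) (by rintro (_ | _) _ <;> rfl))

end Scenario

/-! ### Empirical models and deterministic simulations -/

/-- An empirical model on `X`: for every context `σ` a probability distribution on the joint
outcomes `ℰ(σ)` (a finite set), such that the distribution at a face `τ ⊆ σ` is the marginal of the
one at `σ`. -/
structure EmpiricalModel (X : Scenario.{u}) : Type u where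
  prob : ∀ σ : X.faces, PMF (X.Sections σ.1)
  compat : ∀ (σ τ : X.faces) (h : τ.1 ⊆ σ.1), (prob σ).map (X.restrict h) = prob τ

namespace EmpiricalModel

theorem ext_prob {X : Scenario.{u}} {d e : EmpiricalModel X} (h : ∀ σ, d.prob σ = e.prob σ) :
    d = e := by
  obtain ⟨d, hd⟩ := d
  obtain ⟨e, he⟩ := e
  obtain rfl : d = e := funext h
  rfl

/-- The pushforward `⟨π, h⟩_* d` of an empirical model `d` on `Y` along a deterministic morphism
`⟨π, h⟩ : Y → X`: its distribution at `σ` is the image of `d_{π(σ)}` under `h_σ`. -/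
noncomputable def pushforward {Y X : Scenario.{u}} (f : Y ⟶ X) (d : EmpiricalModel Y) :
    EmpiricalModel X where
  prob σ := (d.prob ⟨f.onMeas '' σ.1, f.simplicial _ σ.2⟩).map
    fun s x => f.onOut x.1 (s ⟨f.onMeas x.1, Set.mem_image_of_mem _ x.2⟩)
  compat σ τ h := by
    rw [← d.compat ⟨f.onMeas '' σ.1, f.simplicial _ σ.2⟩ ⟨f.onMeas '' τ.1, f.simplicial _ τ.2⟩
      (Set.image_mono h), PMF.map_comp, PMF.map_comp]
    rfl

theorem pushforward_id {X : Scenario.{u}} (d : EmpiricalModel X) : pushforward (𝟙 X) d = d := by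
  refine ext_prob fun σ => ?_
  have h : (𝟙 X : X ⟶ X).onMeas '' σ.1 = σ.1 := Set.image_id _
  exact d.compat ⟨_, (𝟙 X : X ⟶ X).simplicial _ σ.2⟩ σ h.ge

theorem pushforward_comp {Z Y X : Scenario.{u}} (f : Z ⟶ Y) (g : Y ⟶ X) (d : EmpiricalModel Z) :
    pushforward (f ≫ g) d = pushforward g (pushforward f d) := by
  refine ext_prob fun σ => ?_
  have h : (f ≫ g).onMeas '' σ.1 = f.onMeas '' (g.onMeas '' σ.1) := Set.image_comp f.onMeas g.onMeas σ.1
  simp only [pushforward]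
  rw [← d.compat ⟨_, f.simplicial _ (g.simplicial _ σ.2)⟩ ⟨_, (f ≫ g).simplicial _ σ.2⟩ h.le,
    PMF.map_comp, PMF.map_comp]
  rfl

/-- The unique empirical model on the scenario with no measurements. -/
noncomputable abbrev zero : EmpiricalModel Scenario.unit.{u} where
  prob _ := PMF.pure fun x => x.1.elim
  compat _ _ _ := by
    rw [PMF.pure_map]
    congr 1

/-- Joining an assignment on the `X`-part and one on the `Y`-part of a set of measurements of
`X ⊗ Y`. -/
def join {X Y : Scenario.{u}} (ρ : Set (Scenario.tensor X Y).Meas)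
    (s : X.Sections (Sum.inl ⁻¹' ρ)) (t : Y.Sections (Sum.inr ⁻¹' ρ)) :
    (Scenario.tensor X Y).Sections ρ
  | ⟨Sum.inl x, hx⟩ => s ⟨x, hx⟩
  | ⟨Sum.inr y, hy⟩ => t ⟨y, hy⟩

/-- The tensor product of empirical models: at the context `σ ⊔ τ` it is the product distribution
of `d_σ` and `e_τ`, i.e. two independent draws `s` and `t` are joined. -/
noncomputable def tensor {X Y : Scenario.{u}} (d : EmpiricalModel X) (e : EmpiricalModel Y) :
    EmpiricalModel (Scenario.tensor X Y) where
  prob ρ := (d.prob ⟨_, ρ.2.1⟩).bind fun s => (e.prob ⟨_, ρ.2.2⟩).map fun t => join ρ.1 s t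
  compat σ τ h := by
    rw [← d.compat ⟨_, σ.2.1⟩ ⟨_, τ.2.1⟩ (Set.preimage_mono h),
      ← e.compat ⟨_, σ.2.2⟩ ⟨_, τ.2.2⟩ (Set.preimage_mono h)]
    simp only [PMF.map_bind, PMF.bind_map, PMF.map_comp]
    congr 1; funext s; simp only [Function.comp]; congr 1; funext t
    funext x
    obtain ⟨x | x, hx⟩ := x <;> rfl

end EmpiricalModel

/-- An object of the category `Emp`: an empirical model, together with the scenario it lives on. -/
structure Emp : Type (u + 1) where
  scenario : Scenario.{u}
  model : EmpiricalModel scenario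

namespace Emp

/-- A deterministic simulation `d → e`: a deterministic morphism `f` of the underlying scenarios
such that `e = f_* d`. -/
structure Hom (d e : Emp.{u}) : Type u where
  mor : d.scenario ⟶ e.scenario
  sim : e.model = EmpiricalModel.pushforward mor d.model

/-- The category `Emp` of empirical models and deterministic simulations. -/
instance : Category.{u} Emp.{u} where
  Hom d e := Hom d e
  id d := ⟨𝟙 d.scenario, (EmpiricalModel.pushforward_id _).symm⟩
  comp f g := ⟨f.mor ≫ g.mor, by rw [EmpiricalModel.pushforward_comp, ← f.sim, ← g.sim]⟩
  id_comp _ := by congr 1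
  comp_id _ := by congr 1
  assoc _ _ _ := by congr 1

theorem hom_ext {d e : Emp.{u}} {f g : d ⟶ e} (h : f.mor = g.mor) : f = g := by
  obtain ⟨f, hf⟩ := f
  obtain ⟨g, hg⟩ := g
  cases h
  rfl

/-! ### The monoidal structure on empirical models -/

/-- The tensor product of empirical models, on the tensor product of their scenarios. -/
noncomputable abbrev tensor (d e : Emp.{u}) : Emp.{u} :=
  ⟨d.scenario.tensor e.scenario, d.model.tensor e.model⟩

/-- The zero model, on the scenario with no measurements. -/
noncomputable abbrev zero : Emp.{u} := ⟨Scenario.unit, EmpiricalModel.zero⟩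

/-- The tensor product of simulations, given by that of the underlying morphisms. -/
def tensorMap {d d' e e' : Emp.{u}} (f : d ⟶ d') (g : e ⟶ e') : tensor d e ⟶ tensor d' e' :=
  ⟨Scenario.tensorMap f.mor g.mor, by
    refine EmpiricalModel.ext_prob fun σ => ?_
    simp only [tensor, f.sim, g.sim]
    simp only [EmpiricalModel.tensor, EmpiricalModel.pushforward, PMF.map_bind, PMF.map_comp]
    rw [← d.model.compat ⟨_, ((Scenario.tensorMap f.mor g.mor).simplicial _ σ.2).1⟩
        ⟨_, f.mor.simplicial _ σ.2.1⟩ (by rintro _ ⟨x, hx, rfl⟩; exact ⟨_, hx, rfl⟩),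
      ← e.model.compat ⟨_, ((Scenario.tensorMap f.mor g.mor).simplicial _ σ.2).2⟩
        ⟨_, g.mor.simplicial _ σ.2.2⟩ (by rintro _ ⟨x, hx, rfl⟩; exact ⟨_, hx, rfl⟩)]
    simp only [PMF.bind_map, PMF.map_comp]
    congr 1; funext s; simp only [Function.comp]; congr 1; funext t
    funext x
    obtain ⟨x | x, hx⟩ := x <;> rfl⟩

/-- The associator of scenarios is a simulation. -/
def assocHom (d e f : Emp.{u}) : tensor (tensor d e) f ⟶ tensor d (tensor e f) :=
  ⟨Scenario.assocHom d.scenario e.scenario f.scenario, by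
    refine EmpiricalModel.ext_prob fun σ => ?_
    have h := (Scenario.assocHom d.scenario e.scenario f.scenario).simplicial _ σ.2
    simp only [tensor, EmpiricalModel.tensor, EmpiricalModel.pushforward, PMF.map_bind,
      PMF.map_comp]
    rw [← d.model.compat ⟨_, h.1.1⟩ ⟨_, σ.2.1⟩ (fun x hx => ⟨_, hx, rfl⟩),
      ← e.model.compat ⟨_, h.1.2⟩ ⟨_, σ.2.2.1⟩ (fun x hx => ⟨_, hx, rfl⟩),
      ← f.model.compat ⟨_, h.2⟩ ⟨_, σ.2.2.2⟩ (fun x hx => ⟨_, hx, rfl⟩)]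
    simp only [PMF.bind_map, PMF.map_comp, PMF.bind_bind]
    congr 1; funext s; simp only [Function.comp_def]
    congr 1; funext t; congr 1; funext r
    funext x
    obtain ⟨x | x | x, hx⟩ := x <;> rfl⟩

/-- The inverse of the associator of scenarios is a simulation. -/
def assocInv (d e f : Emp.{u}) : tensor d (tensor e f) ⟶ tensor (tensor d e) f :=
  ⟨Scenario.assocInv d.scenario e.scenario f.scenario, by
    refine EmpiricalModel.ext_prob fun σ => ?_
    have h := (Scenario.assocInv d.scenario e.scenario f.scenario).simplicial _ σ.2
    simp only [tensor, EmpiricalModel.tensor, EmpiricalModel.pushforward, PMF.map_bind,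
      PMF.map_comp]
    rw [← d.model.compat ⟨_, h.1⟩ ⟨_, σ.2.1.1⟩ (fun x hx => ⟨_, hx, rfl⟩),
      ← e.model.compat ⟨_, h.2.1⟩ ⟨_, σ.2.1.2⟩ (fun x hx => ⟨_, hx, rfl⟩),
      ← f.model.compat ⟨_, h.2.2⟩ ⟨_, σ.2.2⟩ (fun x hx => ⟨_, hx, rfl⟩)]
    simp only [PMF.bind_map, PMF.map_comp, PMF.bind_bind]
    congr 1; funext s; simp only [Function.comp_def, PMF.bind_map]
    congr 1; funext t; congr 1; funext r
    funext x
    obtain ⟨(x | x) | x, hx⟩ := x <;> rfl⟩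

/-- The left unitor of scenarios is a simulation. -/
def leftUnitHom (d : Emp.{u}) : tensor zero d ⟶ d :=
  ⟨Scenario.leftUnitHom d.scenario, by
    refine EmpiricalModel.ext_prob fun σ => ?_
    have h := (Scenario.leftUnitHom d.scenario).simplicial _ σ.2
    simp only [tensor, zero, EmpiricalModel.zero, EmpiricalModel.tensor,
      EmpiricalModel.pushforward, PMF.map_comp, PMF.pure_bind]
    exact (d.model.compat ⟨_, h.2⟩ σ (fun x hx => ⟨_, hx, rfl⟩)).symm⟩

/-- The inverse of the left unitor of scenarios is a simulation. -/
def leftUnitInv (d : Emp.{u}) : d ⟶ tensor zero d :=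
  ⟨Scenario.leftUnitInv d.scenario, by
    refine EmpiricalModel.ext_prob fun σ => ?_
    have h := (Scenario.leftUnitInv d.scenario).simplicial _ σ.2
    simp only [tensor, zero, EmpiricalModel.zero, EmpiricalModel.tensor,
      EmpiricalModel.pushforward, PMF.pure_bind]
    rw [← d.model.compat ⟨_, h⟩ ⟨_, σ.2.2⟩ (fun x hx => ⟨_, hx, rfl⟩), PMF.map_comp]
    congr 1; funext s x
    obtain ⟨⟨⟨⟩⟩ | x, hx⟩ := x
    rfl⟩

/-- The right unitor of scenarios is a simulation. -/
def rightUnitHom (d : Emp.{u}) : tensor d zero ⟶ d :=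
  ⟨Scenario.rightUnitHom d.scenario, by
    refine EmpiricalModel.ext_prob fun σ => ?_
    have h := (Scenario.rightUnitHom d.scenario).simplicial _ σ.2
    simp only [tensor, zero, EmpiricalModel.zero, EmpiricalModel.tensor,
      EmpiricalModel.pushforward, PMF.pure_map, PMF.map_bind]
    exact (d.model.compat ⟨_, h.1⟩ σ (fun x hx => ⟨_, hx, rfl⟩)).symm⟩

/-- The inverse of the right unitor of scenarios is a simulation. -/
def rightUnitInv (d : Emp.{u}) : d ⟶ tensor d zero :=
  ⟨Scenario.rightUnitInv d.scenario, by
    refine EmpiricalModel.ext_prob fun σ => ?_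
    have h := (Scenario.rightUnitInv d.scenario).simplicial _ σ.2
    simp only [tensor, zero, EmpiricalModel.zero, EmpiricalModel.tensor,
      EmpiricalModel.pushforward, PMF.pure_map]
    rw [← d.model.compat ⟨_, h⟩ ⟨_, σ.2.1⟩ (fun x hx => ⟨_, hx, rfl⟩), PMF.bind_map]
    refine congrArg (PMF.bind _) ?_
    funext s
    refine congrArg PMF.pure ?_
    funext x
    obtain ⟨x | ⟨⟨⟩⟩, hx⟩ := x
    rfl⟩

noncomputable instance : MonoidalCategoryStruct Emp.{u} where
  tensorObj := tensor
  tensorHom f g := tensorMap f g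
  whiskerLeft X _ _ g := tensorMap (𝟙 X) g
  whiskerRight f Y := tensorMap f (𝟙 Y)
  tensorUnit := zero
  associator d e f :=
    { hom := assocHom d e f
      inv := assocInv d e f
      hom_inv_id := hom_ext (α_ d.scenario e.scenario f.scenario).hom_inv_id
      inv_hom_id := hom_ext (α_ d.scenario e.scenario f.scenario).inv_hom_id }
  leftUnitor d :=
    { hom := leftUnitHom d
      inv := leftUnitInv d
      hom_inv_id := hom_ext (λ_ d.scenario).hom_inv_id
      inv_hom_id := hom_ext (λ_ d.scenario).inv_hom_id }
  rightUnitor d :=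
    { hom := rightUnitHom d
      inv := rightUnitInv d
      hom_inv_id := hom_ext (ρ_ d.scenario).hom_inv_id
      inv_hom_id := hom_ext (ρ_ d.scenario).inv_hom_id }

/-- The tensor product makes the category of empirical models and deterministic simulations
monoidal. -/
noncomputable instance : MonoidalCategory Emp.{u} :=
  MonoidalCategory.ofTensorHom
    (id_tensorHom_id := fun d e =>
      hom_ext (MonoidalCategory.id_tensorHom_id d.scenario e.scenario))
    (id_tensorHom := fun _ _ _ _ => rfl)
    (tensorHom_id := fun _ _ => rfl)
    (tensorHom_comp_tensorHom := fun f g h k =>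
      hom_ext (MonoidalCategory.tensorHom_comp_tensorHom f.mor g.mor h.mor k.mor))
    (associator_naturality := fun f g h =>
      hom_ext (MonoidalCategory.associator_naturality f.mor g.mor h.mor))
    (leftUnitor_naturality := fun f => hom_ext (MonoidalCategory.leftUnitor_naturality f.mor))
    (rightUnitor_naturality := fun f => hom_ext (MonoidalCategory.rightUnitor_naturality f.mor))
    (pentagon := fun c d e f => hom_ext
      (MonoidalCategory.pentagon c.scenario d.scenario e.scenario f.scenario))
    (triangle := fun d e => hom_ext (MonoidalCategory.triangle d.scenario e.scenario))

end Emp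

/-! ### Comonads from co-Kleisli triples, comonoidal comonads -/

/-- A co-Kleisli triple on a category `C`: an operation `T` on objects, a counit
`ε_X : T X → X` for every object, and an extension operator sending `f : T X → Y` to
`f† : T X → T Y`, subject to `ε_X† = id`, `ε_Y ∘ f† = f` and `(g ∘ f†)† = g† ∘ f†`. -/
structure CokleisliTriple (C : Type v) [Category.{w} C] (T : C → C) where
  counit : ∀ X, T X ⟶ X
  ext : ∀ {X Y}, (T X ⟶ Y) → (T X ⟶ T Y)
  ext_counit : ∀ X, ext (counit X) = 𝟙 (T X)
  ext_comp_counit : ∀ {X Y} (f : T X ⟶ Y), ext f ≫ counit Y = f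
  ext_comp : ∀ {X Y Z} (f : T X ⟶ Y) (g : T Y ⟶ Z), ext (ext f ≫ g) = ext f ≫ ext g

/-- The comonad of a co-Kleisli triple: `f : X → Y` is sent to `(f ∘ ε_X)†`, and the
comultiplication at `X` is `(id_{T X})†`. -/
def CokleisliTriple.comonad {C : Type v} [Category.{w} C] {T : C → C} (S : CokleisliTriple C T) :
    Comonad C where
  obj := T
  map {X _} f := S.ext (S.counit X ≫ f)
  map_id X := by rw [Category.comp_id, S.ext_counit]
  map_comp f g := by rw [← S.ext_comp, ← Category.assoc (S.ext _), S.ext_comp_counit, Category.assoc]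
  ε := { app := S.counit
         naturality := fun _ _ f => S.ext_comp_counit _ }
  δ := { app := fun X => S.ext (𝟙 (T X))
         naturality := fun X Y f => by
          simp only [Functor.comp_map, ← S.ext_comp, Category.comp_id]
          rw [← Category.assoc, S.ext_comp_counit, Category.id_comp] }
  coassoc X := by
    simp only [← S.ext_comp, Category.comp_id]
    rw [← Category.assoc, S.ext_comp_counit, Category.id_comp]
  left_counit X := S.ext_comp_counit _
  right_counit X := by
    simp only [← S.ext_comp]
    rw [← Category.assoc, S.ext_comp_counit, Category.id_comp]
    exact S.ext_counit X

/-- A comonoidal comonad on a monoidal category: the underlying functor `T` carries an oplax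
monoidal structure, given by natural maps `m_{X,Y} : T (X ⊗ Y) → T X ⊗ T Y` and a map
`m_I : T I → I`, for which the counit and the comultiplication are monoidal transformations. -/
structure ComonoidalComonad {C : Type v} [Category.{w} C] [MonoidalCategory C] (T : Comonad C) where
  oplax : T.toFunctor.OplaxMonoidal
  counit_tensor : ∀ X Y : C,
    oplax.δ X Y ≫ (T.ε.app X ⊗ₘ T.ε.app Y) = T.ε.app (X ⊗ Y)
  counit_unit : oplax.η = T.ε.app (𝟙_ C)
  comul_tensor : ∀ X Y : C,
    T.δ.app (X ⊗ Y) ≫ T.toFunctor.map (oplax.δ X Y) ≫ oplax.δ (T.toFunctor.obj X) (T.toFunctor.obj Y) =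
      oplax.δ X Y ≫ (T.δ.app X ⊗ₘ T.δ.app Y)
  comul_unit : T.δ.app (𝟙_ C) ≫ T.toFunctor.map oplax.η ≫ oplax.η = oplax.η

/-! ### Runs and measurement protocols -/

namespace Scenario

/-- Finite sequences `(x_i, o_i)` of measurements together with an outcome. -/
abbrev Word (X : Scenario.{u}) : Type u := List (Σ x : X.Meas, X.Out x)

/-- The set `σ_l` of measurements that occur in `l`. -/
def Word.support {X : Scenario.{u}} (l : X.Word) : Set X.Meas := {x | x ∈ l.map Sigma.fst}

/-- A run: the measurements are distinct and together they form a context. -/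
def IsRun {X : Scenario.{u}} (l : X.Word) : Prop :=
  (l.map Sigma.fst).Nodup ∧ Word.support l ∈ X.faces

/-- Two runs are consistent if they agree on common measurements. -/
def Consistent {X : Scenario.{u}} (l m : X.Word) : Prop :=
  ∀ (z : X.Meas) (o o' : X.Out z), ⟨z, o⟩ ∈ l → ⟨z, o'⟩ ∈ m → o = o'

end Scenario

open Scenario

/-- A measurement protocol on `X`: a non-empty set of runs, closed under prefixes, closed under
changing the outcome of the last measurement, and in which the previous outcomes determine the next
measurement. -/
@[ext]
structure Protocol (X : Scenario.{u}) : Type u where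
  runs : Set X.Word
  isRun : ∀ l ∈ runs, IsRun l
  nonempty : runs.Nonempty
  of_append : ∀ l m : X.Word, l ++ m ∈ runs → l ∈ runs
  all_outcomes : ∀ (l : X.Word) (x : X.Meas) (o o' : X.Out x),
    l ++ [⟨x, o⟩] ∈ runs → l ++ [⟨x, o'⟩] ∈ runs
  determined : ∀ (l : X.Word) (x x' : X.Meas) (o : X.Out x) (o' : X.Out x'),
    l ++ [⟨x, o⟩] ∈ runs → l ++ [⟨x', o'⟩] ∈ runs → x = x'

namespace Protocol

variable {X Y : Scenario.{u}}

theorem nil_mem (Q : Protocol X) : [] ∈ Q.runs := by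
  obtain ⟨l, hl⟩ := Q.nonempty
  exact Q.of_append [] l hl

/-- `l` is a maximal run of `Q`: it is not a proper prefix of any other run of `Q`. -/
def IsMaximal (Q : Protocol X) (l : X.Word) : Prop :=
  l ∈ Q.runs ∧ ∀ m ∈ Q.runs, l <+: m → m = l

theorem finite_isRun (X : Scenario.{u}) : {l : X.Word | IsRun l}.Finite := by
  classical
  have : Fintype (Σ x : X.Meas, X.Out x) := Fintype.ofFinite _
  have h : Finite {l : X.Word // l.Nodup} := inferInstance
  exact Set.Finite.subset (s := {l : X.Word | l.Nodup}) h fun l hl => hl.1.of_map _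

theorem finite_runs (Q : Protocol X) : Q.runs.Finite := (finite_isRun X).subset Q.isRun

theorem exists_isMaximal (Q : Protocol X) : ∃ l, Q.IsMaximal l := by
  obtain ⟨l, hl, h⟩ := Q.finite_runs.exists_maximalFor List.length _ Q.nonempty
  exact ⟨l, hl, fun m hm hlm => (hlm.eq_of_length_le (h hm hlm.length_le)).symm⟩

instance : Finite (Protocol X) := by
  have : Finite {l : X.Word | IsRun l} := finite_isRun X
  refine Finite.of_injective (β := Set {l : X.Word | IsRun l}) (fun Q => {l | l.1 ∈ Q.runs}) ?_
  intro P Q h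
  ext l
  constructor
  · intro hl
    exact (Set.ext_iff.1 h ⟨l, P.isRun l hl⟩).1 hl
  · intro hl
    exact (Set.ext_iff.1 h ⟨l, Q.isRun l hl⟩).2 hl

/-- A set `σ` of measurement protocols is compatible if, for every choice of pairwise consistent
runs, one in each protocol of `σ`, the measurements that occur in them form a context. -/
def Compatible (σ : Set (Protocol X)) : Prop :=
  ∀ r : σ → X.Word, (∀ Q, r Q ∈ Q.1.runs) → (∀ Q Q', Consistent (r Q) (r Q')) →
    (⋃ Q, (r Q).support) ∈ X.faces

theorem Compatible.mono {σ τ : Set (Protocol X)} (hσ : Compatible σ) (h : τ ⊆ σ) :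
    Compatible τ := by
  classical
  intro r hr hc
  have key := hσ (fun Q => if hQ : Q.1 ∈ τ then r ⟨Q, hQ⟩ else []) ?_ ?_
  · refine X.down_closed _ key _ (Set.iUnion_subset fun Q => ?_)
    refine Set.subset_iUnion_of_subset ⟨Q, h Q.2⟩ ?_
    simp [Q.2]
  · intro Q
    split_ifs with hQ
    · exact hr ⟨Q, hQ⟩
    · exact Q.1.nil_mem
  · intro Q Q' z o o'
    split_ifs with hQ hQ'
    · exact hc _ _ z o o'
    all_goals simp

end Protocol

/-- The scenario `MP(X)`: its measurements are the measurement protocols on `X`, the outcomes of a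
protocol are its maximal runs, and its contexts are the compatible sets of protocols. -/
abbrev MP (X : Scenario.{u}) : Scenario.{u} where
  Meas := Protocol X
  Out Q := {l : X.Word // Q.IsMaximal l}
  faces := {σ | Protocol.Compatible σ}
  finite_meas := inferInstance
  finite_out Q := (Q.finite_runs.subset fun _ hl => hl.1 : {l | Q.IsMaximal l}.Finite)
  nonempty_out Q := let ⟨l, hl⟩ := Q.exists_isMaximal; ⟨⟨l, hl⟩⟩
  empty_mem := fun r _ _ => by simpa using X.empty_mem
  down_closed := fun _ hσ _ h => hσ.mono h
  singleton_mem := fun Q r hr _ =>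
    X.down_closed _ (Q.isRun _ (hr ⟨Q, rfl⟩)).2 _
      (Set.iUnion_subset fun ⟨_, hQ'⟩ => by cases hQ'; exact subset_rfl)

/-! ### Measurement protocols over an empirical model -/

/-- The runs of an assignment of maximal runs to protocols are pairwise consistent. -/
def RunsConsistent {X : Scenario.{u}} {σ : Set (Protocol X)} (s : (MP X).Sections σ) : Prop :=
  ∀ Q Q', Consistent (s Q).1 (s Q').1

/-- The joint assignment `⋃_i s_{x̄_i}` on `⋃_i σ_{x̄_i}` determined by pairwise consistent runs
`x̄_i`: a measurement is sent to the outcome that it has in one (hence in any) of the runs in which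
it occurs. -/
noncomputable def jointAssignment {X : Scenario.{u}} {σ : Set (Protocol X)}
    (s : (MP X).Sections σ) : X.Sections (⋃ Q, (s Q).1.support) := fun x =>
  Classical.choose (show ∃ o : X.Out x.1, ∃ Q, (⟨x.1, o⟩ : Σ x, X.Out x) ∈ (s Q).1 by
    obtain ⟨x, hx⟩ := x
    obtain ⟨Q, hQ⟩ := Set.mem_iUnion.1 hx
    obtain ⟨⟨_, o⟩, ho, rfl⟩ := List.mem_map.1 hQ
    exact ⟨o, Q, ho⟩)

open Classical in
/-- The probability that `MP(e)` gives to the joint outcome `s : Q_i ↦ x̄_i` of a compatible set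
`σ` of protocols: the probability of the joint assignment `⋃_i s_{x̄_i}` in `e` if the runs are
pairwise consistent, and `0` otherwise. -/
noncomputable def mpProb {X : Scenario.{u}} (e : EmpiricalModel X) (σ : (MP X).faces)
    (s : (MP X).Sections σ.1) : ENNReal :=
  if h : RunsConsistent s then
    e.prob ⟨⋃ Q, (s Q).1.support, σ.2 _ (fun Q => (s Q).2.1) h⟩ (jointAssignment s)
  else 0

/-! ### The counit -/

/-- The protocol `{Λ} ∪ {x} × O_x` that measures `x` and then stops. -/
def Protocol.single {X : Scenario.{u}} (x : X.Meas) : Protocol X where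
  runs := {[]} ∪ {l | ∃ o : X.Out x, l = [⟨x, o⟩]}
  isRun := by
    rintro l (rfl | ⟨o, rfl⟩)
    · exact ⟨by simp, by simpa [Word.support] using X.empty_mem⟩
    · exact ⟨by simp, by simpa [Word.support] using X.singleton_mem x⟩
  nonempty := ⟨[], Or.inl rfl⟩
  of_append := by
    rintro l m (h | ⟨o, h⟩)
    · exact Or.inl (List.append_eq_nil_iff.1 h).1
    · rcases List.append_eq_singleton_iff.1 h with h | h
      · exact Or.inl h.1
      · exact Or.inr ⟨o, h.1⟩
  all_outcomes := by
    rintro l y o o' (h | ⟨p, h⟩)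
    · simp at h
    · rcases List.append_eq_singleton_iff.1 h with ⟨rfl, h⟩ | h
      · obtain rfl : y = x := congrArg Sigma.fst (List.singleton_injective h)
        exact Or.inr ⟨o', rfl⟩
      · simp at h
  determined := by
    have key : ∀ (l : X.Word) (y : X.Meas) (o : X.Out y),
        l ++ [⟨y, o⟩] ∈ ({[]} ∪ {l | ∃ o : X.Out x, l = [⟨x, o⟩]} : Set X.Word) → y = x := by
      rintro l y o (h | ⟨p, h⟩)
      · simp at h
      · rcases List.append_eq_singleton_iff.1 h with ⟨rfl, h⟩ | h
        · exact congrArg Sigma.fst (List.singleton_injective h)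
        · simp at h
    intro l y y' o o' h h'
    rw [key _ _ _ h, key _ _ _ h']

theorem Protocol.exists_of_isMaximal_single {X : Scenario.{u}} {x : X.Meas} {l : X.Word}
    (h : (Protocol.single x).IsMaximal l) : ∃ o : X.Out x, l = [⟨x, o⟩] := by
  obtain ⟨rfl | h, hm⟩ := h
  · obtain ⟨o⟩ := X.nonempty_out x
    simpa using hm [⟨x, o⟩] (Or.inr ⟨o, rfl⟩) (List.nil_prefix)
  · exact h

/-- The counit `ε_X : MP(X) → X`: a measurement `x` is sent to the protocol that measures `x` and
stops, and the outcome `(x, o)` of this protocol is sent to `o`. -/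
noncomputable def counitMor (X : Scenario.{u}) : MP X ⟶ X where
  onMeas := Protocol.single
  onOut _ l := Classical.choose (Protocol.exists_of_isMaximal_single l.2)
  simplicial σ hσ r hr _ := by
    refine X.down_closed _ hσ _ (Set.iUnion_subset ?_)
    rintro ⟨_, x, hx, rfl⟩ y hy
    obtain h | ⟨o, h⟩ := hr ⟨_, x, hx, rfl⟩
    · rw [h] at hy
      simp [Word.support] at hy
    · rw [h] at hy
      simp only [Word.support, List.map_cons, List.map_nil, List.mem_singleton,
        Set.mem_ofPred_eq] at hy
      exact hy ▸ hx

/-! ### The co-Kleisli extension -/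

open Classical in
/-- The merge `x̄ * ȳ` of two consistent runs: the entries of `ȳ` whose measurement has not been
performed before are appended to `x̄`, in order. -/
noncomputable def merge {X : Scenario.{u}} : X.Word → X.Word → X.Word
  | l, [] => l
  | l, p :: m => if p.1 ∈ Word.support l then merge l m else merge (l ++ [p]) m

/-- For a morphism `⟨π, h⟩ : MP(X) → Y` and a word `ȳ = (y_i, p_i)_{i=1}^n` over `Y`, the word `l`
is of the form `x̄_1 * ⋯ * x̄_n` for pairwise consistent maximal runs `x̄_i` of `π(y_i)` with
`h_{y_i}(x̄_i) = p_i`. -/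
def Interprets {X Y : Scenario.{u}} (f : MP X ⟶ Y) (y : Y.Word) (l : X.Word) : Prop :=
  ∃ xs : List X.Word,
    List.Forall₂ (fun x p => ∃ hx : (f.onMeas p.1).IsMaximal x, f.onOut p.1 ⟨x, hx⟩ = p.2) xs y ∧
      xs.Pairwise Consistent ∧ l = xs.foldl merge []

/-- `g = ⟨π†, h†⟩ : MP(X) → MP(Y)` is the extension of `f = ⟨π, h⟩ : MP(X) → Y`: for every protocol
`Q` on `Y`, the runs of `π† Q` are the prefixes of the words that interpret some run `ȳ ∈ Q`, and
`h†_Q` sends a maximal run of `π† Q` to the maximal run of `Q` that it interprets. -/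
def IsExtension {X Y : Scenario.{u}} (f : MP X ⟶ Y) (g : MP X ⟶ MP Y) : Prop :=
  ∀ Q : Protocol Y,
    (g.onMeas Q).runs = {l | ∃ y ∈ Q.runs, ∃ m, Interprets f y m ∧ l <+: m} ∧
      ∀ x : (MP X).Out (g.onMeas Q), Interprets f (g.onOut Q x).1 x.1

/-! ### The comonoidal transformation -/

section Relabel

variable {X Z : Scenario.{u}} (i : X.Meas → Z.Meas) (j : ∀ x, X.Out x ≃ Z.Out (i x))

/-- Rename the measurements and outcomes of a word. -/
def relabelWord (l : X.Word) : Z.Word := l.map fun p => ⟨i p.1, j p.1 p.2⟩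

variable {i}

theorem relabelWord_injective (hi : i.Injective) : (relabelWord i j).Injective := by
  refine List.map_injective_iff.2 ?_
  rintro ⟨x, o⟩ ⟨x', o'⟩ h
  obtain rfl : x = x' := hi (congrArg Sigma.fst h)
  simpa using h

theorem support_relabelWord (l : X.Word) :
    (relabelWord i j l).support = i '' l.support := by
  ext z
  simp [Word.support, relabelWord]

/-- View a protocol on `X` as a protocol on `Z`, along an injective renaming of the measurements. -/
def Protocol.relabel (hi : i.Injective) (hf : ∀ σ ∈ X.faces, i '' σ ∈ Z.faces) (Q : Protocol X) :
    Protocol Z where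
  runs := relabelWord i j '' Q.runs
  isRun := by
    rintro _ ⟨l, hl, rfl⟩
    refine ⟨?_, support_relabelWord j l ▸ hf _ (Q.isRun l hl).2⟩
    have := (Q.isRun l hl).1.map hi
    simpa [relabelWord, Function.comp_def] using this
  nonempty := Q.nonempty.image _
  of_append := by
    rintro l m ⟨n, hn, h⟩
    obtain ⟨a, b, rfl, rfl, rfl⟩ := List.map_eq_append_iff.1 h
    exact ⟨a, Q.of_append _ _ hn, rfl⟩
  all_outcomes := by
    rintro l z o o' ⟨n, hn, h⟩
    obtain ⟨a, b, rfl, rfl, hb⟩ := List.map_eq_append_iff.1 h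
    obtain ⟨⟨x, p⟩, rfl, hp⟩ := List.map_eq_singleton_iff.1 hb
    obtain rfl : i x = z := congrArg Sigma.fst hp
    exact ⟨a ++ [⟨x, (j x).symm o'⟩], Q.all_outcomes _ _ _ _ hn, by simp [relabelWord]⟩
  determined := by
    rintro l z z' o o' ⟨n, hn, h⟩ ⟨n', hn', h'⟩
    obtain ⟨a, b, rfl, rfl, hb⟩ := List.map_eq_append_iff.1 h
    obtain ⟨⟨x, p⟩, rfl, hp⟩ := List.map_eq_singleton_iff.1 hb
    obtain ⟨a', b', rfl, ha, hb'⟩ := List.map_eq_append_iff.1 h'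
    obtain ⟨⟨x', p'⟩, rfl, hp'⟩ := List.map_eq_singleton_iff.1 hb'
    obtain rfl : a' = a := relabelWord_injective j hi ha
    obtain rfl : i x = z := congrArg Sigma.fst hp
    obtain rfl : i x' = z' := congrArg Sigma.fst hp'
    rw [Q.determined _ _ _ _ _ hn hn']

theorem Protocol.exists_of_isMaximal_relabel (hi : i.Injective)
    (hf : ∀ σ ∈ X.faces, i '' σ ∈ Z.faces) {Q : Protocol X} {l : Z.Word}
    (h : (Q.relabel j hi hf).IsMaximal l) : ∃ m, Q.IsMaximal m ∧ relabelWord i j m = l := by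
  obtain ⟨⟨m, hm, rfl⟩, h⟩ := h
  refine ⟨m, ⟨hm, fun n hn hmn => relabelWord_injective j hi (h _ ⟨n, hn, rfl⟩ ?_)⟩, rfl⟩
  exact hmn.map _

end Relabel

theorem Scenario.inl_image_mem {X Y : Scenario.{u}} (σ : Set X.Meas) (hσ : σ ∈ X.faces) :
    Sum.inl '' σ ∈ (X.tensor Y).faces :=
  ⟨by rwa [Set.preimage_image_eq _ Sum.inl_injective],
    Y.down_closed _ Y.empty_mem _ (by rintro y ⟨x, _, h⟩; cases h)⟩

theorem Scenario.inr_image_mem {X Y : Scenario.{u}} (σ : Set Y.Meas) (hσ : σ ∈ Y.faces) :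
    Sum.inr '' σ ∈ (X.tensor Y).faces :=
  ⟨X.down_closed _ X.empty_mem _ (by rintro y ⟨x, _, h⟩; cases h),
    by rwa [Set.preimage_image_eq _ Sum.inr_injective]⟩

/-- The outcomes of a measurement of `X` are those of its copy in `X ⊗ Y`. -/
def Scenario.inlOut (X Y : Scenario.{u}) (x : X.Meas) : X.Out x ≃ (X.tensor Y).Out (Sum.inl x) :=
  Equiv.refl (X.Out x)

/-- The outcomes of a measurement of `Y` are those of its copy in `X ⊗ Y`. -/
def Scenario.inrOut (X Y : Scenario.{u}) (y : Y.Meas) : Y.Out y ≃ (X.tensor Y).Out (Sum.inr y) :=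
  Equiv.refl (Y.Out y)

/-- A protocol on `X`, seen as a protocol on `X ⊗ Y` that never uses `Y`. -/
def Protocol.inl {X : Scenario.{u}} (Y : Scenario.{u}) (Q : Protocol X) : Protocol (X.tensor Y) :=
  Q.relabel (Z := X.tensor Y) (i := Sum.inl) (Scenario.inlOut X Y) Sum.inl_injective
    Scenario.inl_image_mem

/-- A protocol on `Y`, seen as a protocol on `X ⊗ Y` that never uses `X`. -/
def Protocol.inr (X : Scenario.{u}) {Y : Scenario.{u}} (Q : Protocol Y) : Protocol (X.tensor Y) :=
  Q.relabel (Z := X.tensor Y) (i := Sum.inr) (Scenario.inrOut X Y) Sum.inr_injective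
    Scenario.inr_image_mem

/-- The comonoidal transformation `MP(X ⊗ Y) → MP(X) ⊗ MP(Y)`: a protocol on `X` (or on `Y`) is sent
to the same protocol seen on `X ⊗ Y`, and a maximal run of the latter to the corresponding maximal
run of the former. -/
noncomputable def comonoidalMor (X Y : Scenario.{u}) : MP (X ⊗ Y) ⟶ MP X ⊗ MP Y where
  onMeas := Sum.elim (Protocol.inl Y) (Protocol.inr X)
  onOut := Sum.rec
    (fun _ l => ⟨_, (Classical.choose_spec (Protocol.exists_of_isMaximal_relabel
      (Z := X.tensor Y) (Scenario.inlOut X Y) Sum.inl_injective Scenario.inl_image_mem l.2)).1⟩)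
    (fun _ l => ⟨_, (Classical.choose_spec (Protocol.exists_of_isMaximal_relabel
      (Z := X.tensor Y) (Scenario.inrOut X Y) Sum.inr_injective Scenario.inr_image_mem l.2)).1⟩)
  simplicial := by
    rintro ρ ⟨hX, hY⟩ r hr hc
    constructor
    · choose a ha ha' using fun Q : Sum.inl ⁻¹' ρ => hr ⟨_, _, Q.2, rfl⟩
      refine X.down_closed _ (hX a ha fun Q Q' z o o' ho ho' => ?_) _ ?_
      · refine hc ⟨_, _, Q.2, rfl⟩ ⟨_, _, Q'.2, rfl⟩ (Sum.inl z) o o' ?_ ?_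
        · rw [← ha' Q]; exact List.mem_map.2 ⟨_, ho, rfl⟩
        · rw [← ha' Q']; exact List.mem_map.2 ⟨_, ho', rfl⟩
      · intro x hx
        obtain ⟨⟨_, Q | Q, hQ, rfl⟩, hx⟩ := Set.mem_iUnion.1 hx
        · refine Set.mem_iUnion.2 ⟨⟨Q, hQ⟩, ?_⟩
          rw [← ha' ⟨Q, hQ⟩] at hx
          obtain ⟨y, hy, h⟩ := (support_relabelWord _ _).subset hx
          cases h
          exact hy
        · obtain ⟨b, -, hb⟩ := hr ⟨_, _, hQ, rfl⟩
          rw [← hb] at hx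
          obtain ⟨y, hy, h⟩ := (support_relabelWord _ _).subset hx
          cases h
    · choose a ha ha' using fun Q : Sum.inr ⁻¹' ρ => hr ⟨_, _, Q.2, rfl⟩
      refine Y.down_closed _ (hY a ha fun Q Q' z o o' ho ho' => ?_) _ ?_
      · refine hc ⟨_, _, Q.2, rfl⟩ ⟨_, _, Q'.2, rfl⟩ (Sum.inr z) o o' ?_ ?_
        · rw [← ha' Q]; exact List.mem_map.2 ⟨_, ho, rfl⟩
        · rw [← ha' Q']; exact List.mem_map.2 ⟨_, ho', rfl⟩
      · intro x hx
        obtain ⟨⟨_, Q | Q, hQ, rfl⟩, hx⟩ := Set.mem_iUnion.1 hx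
        · obtain ⟨b, -, hb⟩ := hr ⟨_, _, hQ, rfl⟩
          rw [← hb] at hx
          obtain ⟨y, hy, h⟩ := (support_relabelWord _ _).subset hx
          cases h
        · refine Set.mem_iUnion.2 ⟨⟨Q, hQ⟩, ?_⟩
          rw [← ha' ⟨Q, hQ⟩] at hx
          obtain ⟨y, hy, h⟩ := (support_relabelWord _ _).subset hx
          cases h
          exact hy

/-!
The proof replaces the outcome-dependent order of measurements in a protocol by functions on
*global assignments*, i.e. on families `a` of outcomes for all measurements at once, compatible or
not. Along `a`, a protocol `Q` has exactly one maximal run; it is given by the list `Q.trace a` of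
the measurements that are performed. A protocol is the same as such a function `a ↦ Q.trace a` for
which the lists for `a` and `a'` differ only after a measurement on which `a` and `a'` disagree
(`Branch`, `Protocol.branch_trace`, `Protocol.ofTrace`). Pairwise consistent runs are those that
follow a common global assignment, so that a set of protocols is a context if and only if, for every
`a`, the measurements in the traces along `a` form a context (`Protocol.compatible_iff`).

A deterministic morphism acts on global assignments (`act`), and `a` induces a global assignment
`runsAlong a` on `MP X`. A morphism out of `MP X` is determined by the traces of the protocols in
its image and its action on the assignments `runsAlong a` (`hom_MP_ext`). For the extension of
`f = ⟨π, h⟩`, these are the list that concatenates the traces of the `π y`, with `y` in the trace of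
`Q` along `f_* a`, and keeps first occurrences (`trace_ext`), and `runsAlong (f_* a)` (`act_ext`).
The laws of a co-Kleisli triple and of a comonoidal comonad thereby become identities between lists,
the main one being that repetitions may be removed before or after concatenating
(`firsts_flatMap_firsts`). A word interprets another one precisely if both follow assignments that
correspond under `f` (`interprets_iff`), which identifies the extension with the one defined by
interpretations.

For empirical models, the same calculus applies because every empirical model has a *signed* global
section: a linear functional on functions of global assignments which induces all the distributions
of the model (`EmpiricalModel.exists_isGlobal`). If `I` is one for `e`, then `mpProb e σ s` is the
value of `I` at the indicator function of those `a` for which `runsAlong a` restricts to `s`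
(`toReal_mpProb`). By linearity these values sum to `1` and are compatible with marginals, and the
image of `I` under `runsAlong` is a signed global section of `MP(e)`. A model is determined by a
signed global section, and pushforwards and tensor products of models have the images and products
of the given ones; so the structure maps are simulations since they act correctly on global
assignments.
-/

/-! ### Removing repeated entries, and branching lists -/

section Lists

variable {α β : Type*}

open Classical in
/-- Append to `l`, in order, the entries of `m` that have not occurred before. -/
noncomputable def appendNew (l m : List α) : List α :=
  m.foldl (fun acc x => if x ∈ acc then acc else acc ++ [x]) l

/-- Keep the first occurrence of each entry of a list. (`List.dedup` keeps the last ones.) -/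
noncomputable def firsts (l : List α) : List α := appendNew [] l

theorem appendNew_append (l m n : List α) :
    appendNew l (m ++ n) = appendNew (appendNew l m) n := List.foldl_append

theorem appendNew_singleton_of_mem {l : List α} {x : α} (h : x ∈ l) : appendNew l [x] = l := by
  simp [appendNew, h]

theorem appendNew_singleton_of_notMem {l : List α} {x : α} (h : x ∉ l) :
    appendNew l [x] = l ++ [x] := by
  simp [appendNew, h]

theorem mem_appendNew {l m : List α} {x : α} : x ∈ appendNew l m ↔ x ∈ l ∨ x ∈ m := by
  induction m using List.reverseRecOn with
  | nil => simp [appendNew]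
  | append_singleton m y ih =>
    rw [appendNew_append]
    by_cases hy : y ∈ appendNew l m
    · rw [appendNew_singleton_of_mem hy, ih]
      have := ih.1
      grind
    · rw [appendNew_singleton_of_notMem hy]
      grind

theorem prefix_appendNew (l m : List α) : l <+: appendNew l m := by
  induction m using List.reverseRecOn with
  | nil => exact List.prefix_rfl
  | append_singleton m y ih =>
    rw [appendNew_append]
    by_cases hy : y ∈ appendNew l m
    · rwa [appendNew_singleton_of_mem hy]
    · rw [appendNew_singleton_of_notMem hy]
      exact ih.trans (List.prefix_append _ _)

theorem appendNew_of_subset {l m : List α} (h : m ⊆ l) : appendNew l m = l := by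
  induction m using List.reverseRecOn with
  | nil => rfl
  | append_singleton m y ih =>
    rw [appendNew_append, ih fun x hx => h (by simp [hx]),
      appendNew_singleton_of_mem (h (by simp))]

theorem mem_firsts {l : List α} {x : α} : x ∈ firsts l ↔ x ∈ l := by
  simp [firsts, mem_appendNew]

theorem firsts_append (l m : List α) : firsts (l ++ m) = appendNew (firsts l) m :=
  appendNew_append _ _ _

theorem firsts_append_singleton_of_notMem {l : List α} {x : α} (h : x ∉ l) :
    firsts (l ++ [x]) = firsts l ++ [x] := by
  rw [firsts_append, appendNew_singleton_of_notMem (by rwa [mem_firsts])]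

theorem firsts_append_singleton_of_mem {l : List α} {x : α} (h : x ∈ l) :
    firsts (l ++ [x]) = firsts l := by
  rw [firsts_append, appendNew_singleton_of_mem (by rwa [mem_firsts])]

theorem firsts_prefix {l m : List α} (h : l <+: m) : firsts l <+: firsts m := by
  obtain ⟨n, rfl⟩ := h
  rw [firsts_append]
  exact prefix_appendNew _ _

theorem nodup_firsts (l : List α) : (firsts l).Nodup := by
  induction l using List.reverseRecOn with
  | nil => exact List.nodup_nil
  | append_singleton l y ih =>
    by_cases hy : y ∈ l
    · rwa [firsts_append_singleton_of_mem hy]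
    · rw [firsts_append_singleton_of_notMem hy]
      exact List.nodup_append.2 ⟨ih, by simp, by
        intro a ha b hb
        rw [mem_firsts] at ha
        grind⟩

theorem firsts_of_nodup {l : List α} (h : l.Nodup) : firsts l = l := by
  induction l using List.reverseRecOn with
  | nil => rfl
  | append_singleton l y ih =>
    rw [firsts_append_singleton_of_notMem (by grind), ih (by grind)]

theorem firsts_map {i : α → β} (hi : i.Injective) (l : List α) :
    firsts (l.map i) = (firsts l).map i := by
  induction l using List.reverseRecOn with
  | nil => rfl
  | append_singleton l y ih =>
    rw [List.map_append, List.map_singleton]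
    by_cases hy : y ∈ l
    · rw [firsts_append_singleton_of_mem hy,
        firsts_append_singleton_of_mem (List.mem_map_of_mem hy), ih]
    · rw [firsts_append_singleton_of_notMem hy,
        firsts_append_singleton_of_notMem (by rwa [List.mem_map_of_injective hi]), ih,
        List.map_append, List.map_singleton]

theorem appendNew_firsts (l m : List α) : appendNew l (firsts m) = appendNew l m := by
  induction m using List.reverseRecOn with
  | nil => rfl
  | append_singleton m y ih =>
    rw [appendNew_append l m]
    by_cases hy : y ∈ m
    · rw [firsts_append_singleton_of_mem hy, ih,
        appendNew_singleton_of_mem (mem_appendNew.2 (Or.inr hy))]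
    · rw [firsts_append_singleton_of_notMem hy, appendNew_append, ih]

theorem firsts_flatMap_firsts (φ : α → List β) (l : List α) :
    firsts ((firsts l).flatMap φ) = firsts (l.flatMap φ) := by
  induction l using List.reverseRecOn with
  | nil => rfl
  | append_singleton l y ih =>
    by_cases hy : y ∈ l
    · rw [firsts_append_singleton_of_mem hy, ih, List.flatMap_append, firsts_append,
        appendNew_of_subset]
      intro z hz
      rw [mem_firsts, List.mem_flatMap]
      exact ⟨y, hy, by simpa using hz⟩
    · rw [firsts_append_singleton_of_notMem hy, List.flatMap_append, List.flatMap_append,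
        firsts_append, firsts_append, ih]

theorem firsts_flatMap_firsts_comp (φ : α → List β) (l : List α) :
    firsts (l.flatMap fun x => firsts (φ x)) = firsts (l.flatMap φ) := by
  induction l using List.reverseRecOn with
  | nil => rfl
  | append_singleton l y ih =>
    simp only [List.flatMap_append, List.flatMap_singleton, firsts_append, ih, appendNew_firsts]

/-- The lists `l` and `l'` of questions, asked when the answers are `a` and `a'` respectively, are
the same until an answer differs: either they are equal, and so are all the answers, or there is a
first question that is answered differently, and the lists are equal up to and including it. -/
def Branch {O : α → Type*} (a a' : ∀ x, O x) (l l' : List α) : Prop :=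
  (l = l' ∧ ∀ x ∈ l, a x = a' x) ∨
    ∃ k x, (∀ z ∈ k, a z = a' z) ∧ a x ≠ a' x ∧ k ++ [x] <+: l ∧ k ++ [x] <+: l'

namespace Branch

variable {O : α → Type*} {P : β → Type*} {a a' : ∀ x, O x} {b b' : ∀ y, P y}

theorem nil : Branch a a' [] [] := Or.inl ⟨rfl, by simp⟩

theorem append {l l' m m' : List α} (h : Branch a a' l l') (hm : Branch a a' m m') :
    Branch a a' (l ++ m) (l' ++ m') := by
  obtain ⟨rfl, h⟩ | ⟨k, x, hk, hx, h1, h2⟩ := h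
  · obtain ⟨rfl, hm⟩ | ⟨k, x, hk, hx, h1, h2⟩ := hm
    · exact Or.inl ⟨rfl, by grind⟩
    · refine Or.inr ⟨l ++ k, x, by grind, hx, ?_, ?_⟩
      · simpa using h1
      · simpa using h2
  · exact Or.inr ⟨k, x, hk, hx, h1.trans (List.prefix_append _ _),
      h2.trans (List.prefix_append _ _)⟩

theorem firsts {l l' : List α} (h : Branch a a' l l') :
    Branch a a' (firsts l) (firsts l') := by
  obtain ⟨rfl, h⟩ | ⟨k, x, hk, hx, h1, h2⟩ := h
  · exact Or.inl ⟨rfl, fun x hx => h x (mem_firsts.1 hx)⟩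
  · have hxk : x ∉ k := fun h => hx (hk x h)
    refine Or.inr ⟨_root_.firsts k, x, fun z hz => hk z (mem_firsts.1 hz), hx, ?_, ?_⟩
    · rw [← firsts_append_singleton_of_notMem hxk]; exact firsts_prefix h1
    · rw [← firsts_append_singleton_of_notMem hxk]; exact firsts_prefix h2

/-- If each of the questions of `l` is answered by asking a list of further questions, whose answers
determine the answer of the original one, then the lists of all the further questions branch. -/
theorem flatMap {φ φ' : β → List α} {l l' : List β} (h : Branch b b' l l')
    (hφ : ∀ y, Branch a a' (φ y) (φ' y))
    (hb : ∀ y, φ y = φ' y → (∀ x ∈ φ y, a x = a' x) → b y = b' y) :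
    Branch a a' (l.flatMap φ) (l'.flatMap φ') := by
  have key : ∀ l : List β, Branch a a' (l.flatMap φ) (l.flatMap φ') := by
    intro l
    induction l with
    | nil => exact nil
    | cons y l ih => exact (hφ y).append ih
  obtain ⟨rfl, h⟩ | ⟨k, y, hk, hy, ⟨n, rfl⟩, ⟨n', rfl⟩⟩ := h
  · exact key l
  · obtain ⟨h, hx⟩ | ⟨m, x, hm, hx, h1, h2⟩ := hφ y
    · exact absurd (hb y h hx) hy
    · have hy : Branch a a' (φ y ++ n.flatMap φ) (φ' y ++ n'.flatMap φ') :=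
        Or.inr ⟨m, x, hm, hx, h1.trans (List.prefix_append _ _),
          h2.trans (List.prefix_append _ _)⟩
      simpa using (key k).append hy

end Branch

end Lists

/-! ### Global assignments and the words that follow them -/

namespace Scenario

/-- A global assignment: an outcome for every measurement, compatible or not. -/
abbrev Assignment (X : Scenario.{u}) : Type u := ∀ x, X.Out x

/-- The word that records the outcomes which the global assignment `a` gives to a list of
measurements. -/
def record {X : Scenario.{u}} (a : X.Assignment) (L : List X.Meas) : X.Word :=
  L.map fun x => ⟨x, a x⟩

/-- All the outcomes in the word `l` are those given by `a`. -/
def Follows {X : Scenario.{u}} (a : X.Assignment) (l : X.Word) : Prop := ∀ p ∈ l, a p.1 = p.2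

section Record

variable {X : Scenario.{u}} {a a' : X.Assignment} {L : List X.Meas} {l m : X.Word}

@[simp] theorem map_fst_record : (record a L).map Sigma.fst = L := by
  simp [record, Function.comp_def]

@[simp] theorem support_record : Word.support (record a L) = {x | x ∈ L} := by
  simp [Word.support]

theorem record_append {M : List X.Meas} : record a (L ++ M) = record a L ++ record a M :=
  List.map_append

@[simp] theorem record_singleton {x : X.Meas} : record a [x] = [⟨x, a x⟩] := rfl

theorem mem_record {x : X.Meas} {o : X.Out x} : ⟨x, o⟩ ∈ record a L ↔ x ∈ L ∧ a x = o := by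
  constructor
  · intro h
    obtain ⟨y, hy, h⟩ := List.mem_map.1 h
    cases h
    exact ⟨hy, rfl⟩
  · rintro ⟨h, rfl⟩
    exact List.mem_map.2 ⟨x, h, rfl⟩

theorem follows_record : Follows a' (record a L) ↔ ∀ x ∈ L, a' x = a x := by
  simp [Follows, record]

theorem Follows.eq_record (h : Follows a l) : l = record a (l.map Sigma.fst) := by
  induction l with
  | nil => rfl
  | cons p l ih =>
    have h1 : a p.1 = p.2 := h p (by simp)
    have h2 := ih fun q hq => h q (by simp [hq])
    rw [List.map_cons, record, List.map_cons, h1, ← record, ← h2]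

theorem Follows.of_prefix (h : Follows a m) (hl : l <+: m) : Follows a l :=
  fun p hp => h p (hl.subset hp)

theorem record_congr (h : ∀ x ∈ L, a x = a' x) : record a L = record a' L :=
  List.map_congr_left fun x hx => by rw [h x hx]

theorem prefix_of_record_prefix {K : List X.Meas} (h : record a K <+: record a' L) : K <+: L := by
  have := h.map Sigma.fst
  rwa [map_fst_record, map_fst_record] at this

theorem record_prefix {K : List X.Meas} (h : K <+: L) : record a K <+: record a L := h.map _

theorem exists_assignment (W : Set (Σ x, X.Out x))
    (h : ∀ z (o o' : X.Out z), ⟨z, o⟩ ∈ W → ⟨z, o'⟩ ∈ W → o = o') :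
    ∃ a : X.Assignment, ∀ p ∈ W, a p.1 = p.2 := by
  have : ∀ x, ∃ o : X.Out x, ∀ o', ⟨x, o'⟩ ∈ W → o = o' := by
    intro x
    by_cases hx : ∃ o, ⟨x, o⟩ ∈ W
    · obtain ⟨o, ho⟩ := hx
      exact ⟨o, fun o' ho' => h x o o' ho ho'⟩
    · obtain ⟨o⟩ := X.nonempty_out x
      exact ⟨o, fun o' ho' => absurd ⟨o', ho'⟩ hx⟩
  choose a ha using this
  exact ⟨a, fun p hp => ha p.1 p.2 hp⟩

theorem exists_follows_of_consistent {ι : Type*} {r : ι → X.Word}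
    (h : ∀ i j, Consistent (r i) (r j)) : ∃ a : X.Assignment, ∀ i, Follows a (r i) := by
  obtain ⟨a, ha⟩ := exists_assignment {p | ∃ i, p ∈ r i} (by
    rintro z o o' ⟨i, hi⟩ ⟨j, hj⟩
    exact h i j z o o' hi hj)
  exact ⟨a, fun i p hp => ha p ⟨i, hp⟩⟩

theorem Follows.consistent (hl : Follows a l) (hm : Follows a m) : Consistent l m := by
  intro z o o' h h'
  exact (hl _ h).symm.trans (hm _ h')

theorem IsRun.consistent_self (h : IsRun l) : Consistent l l := by
  intro z o o' ho ho'
  have := List.inj_on_of_nodup_map h.1 ho ho' rfl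
  simpa using this

theorem IsRun.exists_follows (h : IsRun l) : ∃ a : X.Assignment, Follows a l := by
  obtain ⟨a, ha⟩ := exists_follows_of_consistent (ι := Unit) (r := fun _ => l)
    fun _ _ => h.consistent_self
  exact ⟨a, ha ()⟩

end Record

end Scenario

/-! ### The run of a protocol along a global assignment -/

namespace Protocol

variable {X Y : Scenario.{u}}

theorem mem_of_prefix (Q : Protocol X) {l m : X.Word} (hm : m ∈ Q.runs) (h : l <+: m) :
    l ∈ Q.runs := by
  obtain ⟨n, rfl⟩ := h
  exact Q.of_append _ _ hm

/-- Two runs of a protocol are comparable, unless some measurement has different outcomes. -/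
theorem prefix_or_prefix_or_split (Q : Protocol X) {l m : X.Word} (hl : l ∈ Q.runs)
    (hm : m ∈ Q.runs) : l <+: m ∨ m <+: l ∨
      ∃ k x o o', o ≠ o' ∧ k ++ [⟨x, o⟩] <+: l ∧ k ++ [⟨x, o'⟩] <+: m := by
  induction l using List.reverseRecOn with
  | nil => exact Or.inl List.nil_prefix
  | append_singleton l p ih =>
    obtain h | h | ⟨k, x, o, o', ho, h1, h2⟩ := ih (Q.of_append _ _ hl)
    · obtain ⟨n, rfl⟩ := h
      obtain _ | ⟨q, n⟩ := n
      · exact Or.inr (Or.inl (by simp))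
      · obtain ⟨x, o⟩ := p
        obtain ⟨y, o'⟩ := q
        have hq : l ++ [⟨y, o'⟩] <+: l ++ ⟨y, o'⟩ :: n := ⟨n, by simp⟩
        obtain rfl := Q.determined _ _ _ _ _ hl (Q.mem_of_prefix hm hq)
        by_cases h : o = o'
        · subst h
          exact Or.inl hq
        · exact Or.inr (Or.inr ⟨l, x, o, o', h, List.prefix_rfl, hq⟩)
    · exact Or.inr (Or.inl (h.trans (List.prefix_append _ _)))
    · exact Or.inr (Or.inr ⟨k, x, o, o', ho, h1.trans (List.prefix_append _ _), h2⟩)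

theorem exists_isMaximal_record (Q : Protocol X) (a : X.Assignment) :
    ∃ L, Q.IsMaximal (record a L) := by
  have hfin : {l | l ∈ Q.runs ∧ Follows a l}.Finite := Q.finite_runs.subset fun l hl => hl.1
  obtain ⟨l, ⟨hl, hla⟩, h⟩ := hfin.exists_maximalFor List.length _
    ⟨[], Q.nil_mem, by simp [Follows]⟩
  refine ⟨l.map Sigma.fst, ?_⟩
  rw [← hla.eq_record]
  refine ⟨hl, ?_⟩
  rintro _ hm ⟨_ | ⟨⟨x, o⟩, m⟩, rfl⟩
  · simp
  · have h1 : l ++ [⟨x, o⟩] ∈ Q.runs := Q.mem_of_prefix hm ⟨m, by simp⟩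
    have h2 := h ⟨Q.all_outcomes l x o (a x) h1, by
      intro p hp
      obtain hp | hp := List.mem_append.1 hp
      · exact hla p hp
      · obtain rfl := List.mem_singleton.1 hp
        rfl⟩ (by simp)
    simp at h2

/-- The list of the measurements that the protocol `Q` performs if the outcomes are given by the
global assignment `a`. -/
noncomputable def trace (Q : Protocol X) (a : X.Assignment) : List X.Meas :=
  Classical.choose (Q.exists_isMaximal_record a)

theorem isMaximal_record_trace (Q : Protocol X) (a : X.Assignment) :
    Q.IsMaximal (record a (Q.trace a)) :=
  Classical.choose_spec (Q.exists_isMaximal_record a)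

theorem prefix_record_trace (Q : Protocol X) {a : X.Assignment} {l : X.Word} (hl : l ∈ Q.runs)
    (h : Follows a l) : l <+: record a (Q.trace a) := by
  obtain h' | h' | ⟨k, x, o, o', ho, h1, h2⟩ :=
    Q.prefix_or_prefix_or_split hl (Q.isMaximal_record_trace a).1
  · exact h'
  · rw [(Q.isMaximal_record_trace a).2 l hl h']
  · have h3 : a x = o := h ⟨x, o⟩ (h1.subset (by simp))
    have h4 : a x = o' := (mem_record.1 (h2.subset (by simp))).2
    exact absurd (h3.symm.trans h4) ho

theorem IsMaximal.eq_record_trace {Q : Protocol X} {a : X.Assignment} {l : X.Word}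
    (hl : Q.IsMaximal l) (h : Follows a l) : l = record a (Q.trace a) :=
  (hl.2 _ (Q.isMaximal_record_trace a).1 (Q.prefix_record_trace hl.1 h)).symm

theorem trace_eq {Q : Protocol X} {a : X.Assignment} {L : List X.Meas}
    (h : Q.IsMaximal (record a L)) : Q.trace a = L := by
  have := h.eq_record_trace (follows_record.2 fun _ _ => rfl)
  simpa using (congrArg (List.map Sigma.fst) this).symm

theorem trace_congr (Q : Protocol X) {a a' : X.Assignment} (h : ∀ x ∈ Q.trace a, a x = a' x) :
    Q.trace a' = Q.trace a := by
  apply trace_eq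
  rw [← record_congr h]
  exact Q.isMaximal_record_trace a

theorem mem_runs_iff (Q : Protocol X) {l : X.Word} :
    l ∈ Q.runs ↔ ∃ a, l <+: record a (Q.trace a) := by
  constructor
  · intro hl
    obtain ⟨a, ha⟩ := (Q.isRun l hl).exists_follows
    exact ⟨a, Q.prefix_record_trace hl ha⟩
  · rintro ⟨a, ha⟩
    exact Q.mem_of_prefix (Q.isMaximal_record_trace a).1 ha

theorem eq_of_trace {P Q : Protocol X} (h : ∀ a, P.trace a = Q.trace a) : P = Q := by
  ext l
  simp only [mem_runs_iff, h]

theorem nodup_trace (Q : Protocol X) (a : X.Assignment) : (Q.trace a).Nodup := by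
  simpa using (Q.isRun _ (Q.isMaximal_record_trace a).1).1

theorem trace_mem_faces (Q : Protocol X) (a : X.Assignment) : {x | x ∈ Q.trace a} ∈ X.faces := by
  simpa using (Q.isRun _ (Q.isMaximal_record_trace a).1).2

/-- Previous outcomes determine the next measurement, so traces part only at a measurement with
different outcomes. -/
theorem branch_trace (Q : Protocol X) (a a' : X.Assignment) :
    Branch a a' (Q.trace a) (Q.trace a') := by
  have ha := Q.isMaximal_record_trace a
  have ha' := Q.isMaximal_record_trace a'
  have key : ∀ {b b' : X.Assignment} {L L' : List X.Meas}, record b L = record b' L' →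
      L = L' ∧ ∀ x ∈ L, b x = b' x := by
    intro b b' L L' h
    obtain rfl : L = L' := by simpa using congrArg (List.map Sigma.fst) h
    refine ⟨rfl, fun x hx => ?_⟩
    have : (⟨x, b x⟩ : Σ x, X.Out x) ∈ record b' L := h ▸ mem_record.2 ⟨hx, rfl⟩
    exact (mem_record.1 this).2.symm
  obtain h | h | ⟨k, x, o, o', ho, h1, h2⟩ := Q.prefix_or_prefix_or_split ha.1 ha'.1
  · exact Or.inl (key (ha.2 _ ha'.1 h).symm)
  · exact Or.inl (key (ha'.2 _ ha.1 h))
  · have f1 : Follows a (k ++ [⟨x, o⟩]) := (follows_record.2 fun _ _ => rfl).of_prefix h1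
    have f2 : Follows a' (k ++ [⟨x, o'⟩]) := (follows_record.2 fun _ _ => rfl).of_prefix h2
    refine Or.inr ⟨k.map Sigma.fst, x, ?_, ?_, ?_, ?_⟩
    · intro z hz
      obtain ⟨p, hp, rfl⟩ := List.mem_map.1 hz
      rw [f1 p (by simp [hp]), f2 p (by simp [hp])]
    · intro h
      exact ho ((f1 ⟨x, o⟩ (by simp)).symm.trans (h.trans (f2 ⟨x, o'⟩ (by simp))))
    · simpa using h1.map Sigma.fst
    · simpa using h2.map Sigma.fst

/-- A protocol given by the lists of measurements that it performs along the global assignments. -/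
def ofTrace (T : X.Assignment → List X.Meas) (nodup : ∀ a, (T a).Nodup)
    (faces : ∀ a, {x | x ∈ T a} ∈ X.faces) (branch : ∀ a a', Branch a a' (T a) (T a')) :
    Protocol X where
  runs := {l | ∃ a, l <+: record a (T a)}
  isRun := by
    rintro l ⟨a, h⟩
    refine ⟨?_, X.down_closed _ (faces a) _ ?_⟩
    · have h' := h.map Sigma.fst
      rw [map_fst_record] at h'
      exact (nodup a).sublist h'.sublist
    · intro x hx
      have h' := h.map Sigma.fst
      rw [map_fst_record] at h'
      exact h'.subset hx
  nonempty := ⟨[], fun x => (X.nonempty_out x).some, List.nil_prefix⟩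
  of_append := by
    rintro l m ⟨a, h⟩
    exact ⟨a, (List.prefix_append _ _).trans h⟩
  all_outcomes := by
    classical
    rintro l x o o' ⟨a, h⟩
    have f := (follows_record.2 fun _ _ => rfl : Follows a _).of_prefix h
    have hl : Follows a l := f.of_prefix (List.prefix_append _ _)
    obtain rfl : a x = o := f ⟨x, o⟩ (by simp)
    have h' : l.map Sigma.fst ++ [x] <+: T a := by simpa using h.map Sigma.fst
    have hne : ∀ z, a z ≠ Function.update a x o' z → z = x := by
      intro z hz
      by_contra hzx
      rw [Function.update_of_ne hzx] at hz
      exact hz rfl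
    refine ⟨Function.update a x o', ?_⟩
    obtain ⟨h1, h2⟩ | ⟨k, z, hk, hz, h1, h2⟩ := branch a (Function.update a x o')
    · rw [← h1, ← record_congr h2]
      have := h2 x (h'.subset (by simp))
      rw [Function.update_self] at this
      rwa [← this]
    · obtain rfl := hne z hz
      -- an entry of a list without repetitions is preceded by only one prefix
      have hkl : k = l.map Sigma.fst := by
        have hn := nodup a
        obtain hp | hp := List.prefix_or_prefix_of_prefix h1 h'
        · obtain hp | hp := List.prefix_concat_iff.1 hp
          · exact (List.append_singleton_inj.1 hp).1
          · have := hn.sublist h'.sublist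
            have := hp.subset (by simp : z ∈ k ++ [z])
            grind
        · obtain hp | hp := List.prefix_concat_iff.1 hp
          · exact (List.append_singleton_inj.1 hp).1.symm
          · have := hn.sublist h1.sublist
            have := hp.subset (by simp : z ∈ l.map Sigma.fst ++ [z])
            grind
      subst hkl
      have := record_prefix (a := Function.update a z o') h2
      rw [record_append, ← record_congr hk, ← hl.eq_record] at this
      simpa using this
  determined := by
    rintro l x x' o o' ⟨a, h⟩ ⟨a', h'⟩
    have g : l.map Sigma.fst ++ [x] <+: T a := by simpa using h.map Sigma.fst
    have g' : l.map Sigma.fst ++ [x'] <+: T a' := by simpa using h'.map Sigma.fst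
    have f : Follows a l := (follows_record.2 fun _ _ => rfl : Follows a _).of_prefix
      ((List.prefix_append _ _).trans h)
    have f' : Follows a' l := (follows_record.2 fun _ _ => rfl : Follows a' _).of_prefix
      ((List.prefix_append _ _).trans h')
    -- whichever list the two prefixes are compared in, they have the same length
    have key : ∀ {K : List X.Meas}, l.map Sigma.fst ++ [x] <+: K →
        l.map Sigma.fst ++ [x'] <+: K → x = x' := by
      intro K h h'
      have := List.prefix_of_prefix_length_le h h' (by simp)
      exact (List.append_singleton_inj.1 (this.eq_of_length (by simp))).2
    obtain ⟨h1, -⟩ | ⟨k, z, hk, hz, h1, h2⟩ := branch a a'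
    · rw [← h1] at g'
      exact key g g'
    · obtain hp | hp := List.prefix_or_prefix_of_prefix h1 g
      · obtain hp | hp := List.prefix_concat_iff.1 hp
        · have e1 := List.append_singleton_inj.1 hp
          rw [e1.1, e1.2] at h2
          exact key h2 g'
        · obtain ⟨p, hpl, hpz⟩ := List.mem_map.1 (hp.subset (by simp : z ∈ k ++ [z]))
          subst hpz
          exact absurd ((f p hpl).trans (f' p hpl).symm) hz
      · have hx : l.map Sigma.fst ++ [x] <+: T a' := hp.trans h2
        exact key hx g'

theorem trace_ofTrace {T : X.Assignment → List X.Meas} {nodup : ∀ a, (T a).Nodup}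
    {faces : ∀ a, {x | x ∈ T a} ∈ X.faces} {branch : ∀ a a', Branch a a' (T a) (T a')}
    (a : X.Assignment) : (ofTrace T nodup faces branch).trace a = T a := by
  have hT : record a (T a) ∈ (ofTrace T nodup faces branch).runs := ⟨a, List.prefix_rfl⟩
  refine trace_eq ⟨hT, ?_⟩
  rintro m ⟨a', hm⟩ h
  have g := prefix_of_record_prefix (h.trans hm)
  obtain ⟨h1, h2⟩ | ⟨k, z, hk, hz, h1, h2⟩ := branch a a'
  · rw [record_congr h2, h1] at h ⊢
    exact (h.eq_of_length_le hm.length_le).symm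
  · -- the answer to the question `z` is recorded both as `a z` and as `a' z`
    have := (h.trans hm).subset (mem_record.2 ⟨h1.subset (by simp : z ∈ k ++ [z]), rfl⟩)
    exact absurd (mem_record.1 this).2.symm hz

/-- Consistent runs follow a common global assignment, along which they extend to maximal ones. -/
theorem compatible_iff {σ : Set (Protocol X)} :
    Compatible σ ↔ ∀ a, {x | ∃ Q ∈ σ, x ∈ Q.trace a} ∈ X.faces := by
  constructor
  · intro h a
    refine X.down_closed _ (h (fun Q => record a (Q.1.trace a))
      (fun Q => (Q.1.isMaximal_record_trace a).1) fun Q Q' => ?_) _ ?_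
    · exact (follows_record.2 fun _ _ => rfl).consistent (follows_record.2 fun _ _ => rfl)
    · rintro x ⟨Q, hQ, hx⟩
      exact Set.mem_iUnion.2 ⟨⟨Q, hQ⟩, by simpa using hx⟩
  · intro h r hr hc
    obtain ⟨a, ha⟩ := exists_follows_of_consistent hc
    refine X.down_closed _ (h a) _ (Set.iUnion_subset fun Q x hx => ⟨Q.1, Q.2, ?_⟩)
    have := ((Q.1.prefix_record_trace (hr Q) (ha Q)).map Sigma.fst).subset hx
    simpa using this

theorem trace_single (x : X.Meas) (a : X.Assignment) : (single x).trace a = [x] := by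
  refine trace_eq ⟨Or.inr ⟨a x, rfl⟩, ?_⟩
  rintro m (rfl | ⟨o, rfl⟩) h
  · simp [record] at h
  · exact (h.eq_of_length rfl).symm

theorem trace_relabel {i : X.Meas → Y.Meas} (j : ∀ x, X.Out x ≃ Y.Out (i x)) (hi : i.Injective)
    (hf : ∀ σ ∈ X.faces, i '' σ ∈ Y.faces) (Q : Protocol X) (a : Y.Assignment) :
    (Q.relabel j hi hf).trace a = (Q.trace fun x => (j x).symm (a (i x))).map i := by
  have hrec : ∀ L, record a (L.map i) =
      relabelWord i j (record (fun x => (j x).symm (a (i x))) L) := by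
    intro L
    simp [record, relabelWord]
  have h := Q.isMaximal_record_trace fun x => (j x).symm (a (i x))
  apply trace_eq
  rw [hrec]
  refine ⟨⟨_, h.1, rfl⟩, ?_⟩
  rintro _ ⟨m, hm, rfl⟩ hp
  rw [h.2 m hm]
  obtain ⟨n, hn⟩ := hp
  obtain ⟨c, d, rfl, hc, -⟩ := List.map_eq_append_iff.1 hn.symm
  rw [← relabelWord_injective j hi hc]
  exact List.prefix_append _ _

end Protocol

/-! ### The co-Kleisli triple on scenarios -/

namespace Scenario

/-- The action of a deterministic morphism on global assignments. -/
def act {X Y : Scenario.{u}} (f : X ⟶ Y) (a : X.Assignment) : Y.Assignment :=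
  fun y => f.onOut y (a (f.onMeas y))

/-- The global assignment on `MP X` induced by one on `X`: the outcome of a protocol is its maximal
run along the assignment. -/
noncomputable def runsAlong {X : Scenario.{u}} (a : X.Assignment) : (MP X).Assignment :=
  fun Q => ⟨record a (Q.trace a), Q.isMaximal_record_trace a⟩

variable {X Y Z : Scenario.{u}}

theorem act_comp (f : X ⟶ Y) (g : Y ⟶ Z) (a : X.Assignment) : act (f ≫ g) a = act g (act f a) :=
  rfl

theorem runsAlong_congr {Q : Protocol X} {a a' : X.Assignment}
    (h : ∀ x ∈ Q.trace a, a x = a' x) : runsAlong a Q = runsAlong a' Q := by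
  apply Subtype.ext
  simp only [runsAlong, Q.trace_congr h, record_congr h]

theorem exists_eq_runsAlong {Q : Protocol X} (l : (MP X).Out Q) : ∃ a, l = runsAlong a Q := by
  obtain ⟨a, ha⟩ := (Q.isRun _ l.2.1).exists_follows
  exact ⟨a, Subtype.ext (l.2.eq_record_trace ha)⟩

/-- A morphism out of `MP X` is determined by what it does along global assignments on `X`. -/
theorem hom_MP_ext {f g : MP X ⟶ Z}
    (h : ∀ z a, (f.onMeas z).trace a = (g.onMeas z).trace a)
    (h' : ∀ a, act f (runsAlong a) = act g (runsAlong a)) : f = g := by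
  have e : ∀ z, f.onMeas z = g.onMeas z := fun z => Protocol.eq_of_trace (h z)
  refine hom_ext e fun z l => ?_
  obtain ⟨a, rfl⟩ := exists_eq_runsAlong l
  have key : ∀ {P Q : Protocol X} (h : P = Q),
      cast (congrArg (MP X).Out h) (runsAlong a P) = runsAlong a Q := by
    rintro P _ rfl
    rfl
  rw [key (e z)]
  exact congrFun (h' a) z

/-- The list of measurements that the extension of `f` performs for the protocol `Q` on `Y`: `Q` is
followed, and each of its measurements `y` is replaced by the protocol that `f` assigns to `y`,
leaving out repetitions. -/
noncomputable def extTrace (f : MP X ⟶ Y) (Q : Protocol Y) (a : X.Assignment) : List X.Meas :=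
  firsts ((Q.trace (act f (runsAlong a))).flatMap fun y => (f.onMeas y).trace a)

theorem mem_extTrace {f : MP X ⟶ Y} {Q : Protocol Y} {a : X.Assignment} {x : X.Meas} :
    x ∈ extTrace f Q a ↔
      ∃ y ∈ Q.trace (act f (runsAlong a)), x ∈ (f.onMeas y).trace a := by
  rw [extTrace, mem_firsts, List.mem_flatMap]

theorem branch_extTrace (f : MP X ⟶ Y) (Q : Protocol Y) (a a' : X.Assignment) :
    Branch a a' (extTrace f Q a) (extTrace f Q a') :=
  ((Q.branch_trace _ _).flatMap (fun y => (f.onMeas y).branch_trace a a') fun y _ h => by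
    simp only [act, runsAlong_congr h]).firsts

theorem trace_union_mem_faces (f : MP X ⟶ Y) {τ : Set Y.Meas} (hτ : τ ∈ Y.faces)
    (a : X.Assignment) : {x | ∃ y ∈ τ, x ∈ (f.onMeas y).trace a} ∈ X.faces := by
  have := Protocol.compatible_iff.1 (f.simplicial τ hτ) a
  simpa using this

/-- The protocol that the extension of `f` assigns to the protocol `Q` on `Y`. -/
noncomputable def extProtocol (f : MP X ⟶ Y) (Q : Protocol Y) : Protocol X :=
  Protocol.ofTrace (extTrace f Q) (fun _ => nodup_firsts _)
    (fun a => by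
      simp only [mem_extTrace]
      exact trace_union_mem_faces f (Q.trace_mem_faces _) a)
    (branch_extTrace f Q)

theorem trace_extProtocol (f : MP X ⟶ Y) (Q : Protocol Y) (a : X.Assignment) :
    (extProtocol f Q).trace a = extTrace f Q a :=
  Protocol.trace_ofTrace (branch := branch_extTrace f Q) a

/-- The co-Kleisli extension `f†` of a morphism `f : MP X ⟶ Y`. -/
noncomputable def ext (f : MP X ⟶ Y) : MP X ⟶ MP Y where
  onMeas := extProtocol f
  onOut _ l := runsAlong (act f (runsAlong (Classical.choose (exists_eq_runsAlong l)))) _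
  simplicial σ hσ := by
    refine Protocol.compatible_iff.2 fun a => ?_
    have := trace_union_mem_faces f (Protocol.compatible_iff.1 hσ (act f (runsAlong a))) a
    refine X.down_closed _ this _ ?_
    rintro x ⟨_, ⟨Q, hQ, rfl⟩, hx⟩
    rw [trace_extProtocol, mem_extTrace] at hx
    obtain ⟨y, hy, hx⟩ := hx
    exact ⟨y, ⟨Q, hQ, hy⟩, hx⟩

theorem trace_ext (f : MP X ⟶ Y) (Q : Protocol Y) (a : X.Assignment) :
    ((ext f).onMeas Q).trace a =
      firsts ((Q.trace (act f (runsAlong a))).flatMap fun y => (f.onMeas y).trace a) :=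
  trace_extProtocol f Q a

/-- Extending a morphism commutes with passing from global assignments to maximal runs, even though
the assignment from which a maximal run comes is not unique. -/
theorem act_ext (f : MP X ⟶ Y) (a : X.Assignment) :
    act (ext f) (runsAlong a) = runsAlong (act f (runsAlong a)) := by
  funext Q
  have h := Classical.choose_spec (exists_eq_runsAlong (runsAlong a ((ext f).onMeas Q)))
  set a' := Classical.choose (exists_eq_runsAlong (runsAlong a ((ext f).onMeas Q)))
  change runsAlong (act f (runsAlong a')) Q = _
  refine (runsAlong_congr fun y hy => ?_).symm
  refine congrArg (f.onOut y) (runsAlong_congr fun x hx => ?_)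
  -- `a'` agrees with `a` on all the measurements in the run of the extended protocol along `a`
  have hx' : x ∈ ((ext f).onMeas Q).trace a := by
    rw [trace_ext, mem_firsts, List.mem_flatMap]
    exact ⟨y, hy, hx⟩
  have : (⟨x, a x⟩ : Σ x, X.Out x) ∈ (runsAlong a ((ext f).onMeas Q)).1 :=
    mem_record.2 ⟨hx', rfl⟩
  rw [h] at this
  exact (mem_record.1 this).2.symm

theorem act_counitMor (a : X.Assignment) : act (counitMor X) (runsAlong a) = a := by
  funext x
  have h := Classical.choose_spec
    (Protocol.exists_of_isMaximal_single (runsAlong a (Protocol.single x)).2)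
  have h' : (runsAlong a (Protocol.single x)).1 = [⟨x, a x⟩] := by
    simp [runsAlong, Protocol.trace_single, record]
  exact (eq_of_heq (Sigma.mk.inj (List.singleton_injective (h'.symm.trans h))).2).symm

/-- The co-Kleisli triple of measurement protocols. -/
noncomputable def cokleisli : CokleisliTriple Scenario.{u} MP where
  counit := counitMor
  ext := ext
  ext_counit X := by
    refine hom_MP_ext (fun Q a => ?_) fun a => ?_
    · rw [trace_ext, act_counitMor]
      simp only [counitMor, Protocol.trace_single, List.flatMap_singleton']
      exact firsts_of_nodup (Q.nodup_trace a)
    · rw [act_ext, act_counitMor]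
      rfl
  ext_comp_counit f := by
    refine hom_MP_ext (fun y a => ?_) fun a => ?_
    · change ((ext f).onMeas (Protocol.single y)).trace a = _
      rw [trace_ext, Protocol.trace_single, List.flatMap_singleton]
      exact firsts_of_nodup (Protocol.nodup_trace _ a)
    · rw [act_comp, act_ext, act_counitMor]
  ext_comp f g := by
    refine hom_MP_ext (fun R a => ?_) fun a => ?_
    · change _ = ((ext f).onMeas ((ext g).onMeas R)).trace a
      rw [trace_ext, trace_ext, trace_ext, firsts_flatMap_firsts, List.flatMap_assoc, act_comp,
        act_ext]
      refine Eq.trans ?_ (firsts_flatMap_firsts_comp _ _)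
      congr 2
      funext z
      exact trace_ext f _ a
    · rw [act_ext, act_comp, act_comp, act_ext, act_ext]

/-! ### The extension in terms of interpretations -/

theorem merge_record (a : X.Assignment) (L M : List X.Meas) :
    merge (record a L) (record a M) = record a (appendNew L M) := by
  classical
  induction M generalizing L with
  | nil => rfl
  | cons x M ih =>
    have e : record a (x :: M) = ⟨x, a x⟩ :: record a M := rfl
    rw [e, merge, support_record, show x :: M = [x] ++ M from rfl, appendNew_append]
    by_cases hx : x ∈ L
    · rw [if_pos (show _ ∈ {x | x ∈ L} from hx), ih, appendNew_singleton_of_mem hx]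
    · rw [if_neg (show _ ∉ {x | x ∈ L} from hx), appendNew_singleton_of_notMem hx, ← ih,
        record_append, record_singleton]

theorem foldl_merge_record (a : X.Assignment) (Ls : List (List X.Meas)) :
    (Ls.map (record a)).foldl merge [] = record a (firsts Ls.flatten) := by
  induction Ls using List.reverseRecOn with
  | nil => rfl
  | append_singleton Ls L ih =>
    rw [List.map_append, List.foldl_append, ih, List.flatten_append, firsts_append,
      ← List.flatMap_id, ← merge_record]
    simp

/-- The word that interprets `y` along the global assignment `a`. -/
noncomputable def interpretation (f : MP X ⟶ Y) (a : X.Assignment) (y : Y.Word) : X.Word :=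
  record a (firsts ((y.map Sigma.fst).flatMap fun z => (f.onMeas z).trace a))

/-- Consistent maximal runs that interpret a word all follow one global assignment, which in turn
determines them. -/
theorem interprets_iff {f : MP X ⟶ Y} {y : Y.Word} {l : X.Word} :
    Interprets f y l ↔ ∃ a, Follows (act f (runsAlong a)) y ∧ l = interpretation f a y := by
  have hmerge : ∀ a : X.Assignment, interpretation f a y =
      (y.map fun p => record a ((f.onMeas p.1).trace a)).foldl merge [] := by
    intro a
    rw [interpretation, List.flatMap_def, ← foldl_merge_record]
    simp [Function.comp_def]
  constructor
  · rintro ⟨xs, hxs, hc, rfl⟩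
    have hself : ∀ x ∈ xs, Consistent x x := by
      intro x hx
      obtain ⟨i, hi, rfl⟩ := List.mem_iff_getElem.1 hx
      obtain ⟨h, -⟩ := hxs.get hi (hxs.length_eq ▸ hi)
      exact ((f.onMeas _).isRun _ h.1).consistent_self
    have hc' : ∀ i j : {x // x ∈ xs}, Consistent i.1 j.1 := by
      intro i j
      exact List.Pairwise.forall_of_forall_of_flip hself hc
        (hc.imp fun h z o o' ho ho' => (h z o' o ho' ho).symm) i.2 j.2
    obtain ⟨a, ha⟩ := exists_follows_of_consistent hc'
    have hp : xs = y.map (fun p => record a ((f.onMeas p.1).trace a)) ∧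
        Follows (act f (runsAlong a)) y := by
      clear hc hc' hself hmerge
      induction hxs with
      | nil => exact ⟨rfl, by simp [Follows]⟩
      | @cons x p xs y h hxs ih =>
        obtain ⟨h, ho⟩ := h
        obtain ⟨ih1, ih2⟩ := ih fun i => ha ⟨i.1, by simp [i.2]⟩
        have hx := h.eq_record_trace (ha ⟨x, by simp⟩)
        refine ⟨by rw [List.map_cons, ← ih1, ← hx], ?_⟩
        intro q hq
        obtain rfl | hq := List.mem_cons.1 hq
        · rw [← ho]
          exact congrArg (f.onOut q.1) (Subtype.ext hx.symm)
        · exact ih2 q hq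
    exact ⟨a, hp.2, by rw [hmerge, ← hp.1]⟩
  · rintro ⟨a, ha, rfl⟩
    refine ⟨_, ?_, ?_, hmerge a⟩
    · rw [List.forall₂_map_left_iff, List.forall₂_same]
      exact fun p hp => ⟨(f.onMeas p.1).isMaximal_record_trace a, ha p hp⟩
    · rw [List.pairwise_map]
      refine List.pairwise_of_forall fun _ _ => ?_
      exact (follows_record.2 fun _ _ => rfl).consistent (follows_record.2 fun _ _ => rfl)

theorem interpretation_record (f : MP X ⟶ Y) (Q : Protocol Y) (a : X.Assignment) :
    interpretation f a (record (act f (runsAlong a)) (Q.trace (act f (runsAlong a)))) =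
      record a (((ext f).onMeas Q).trace a) := by
  rw [interpretation, map_fst_record, trace_ext]

/-- A maximal run of a protocol on `Y` is determined by any of its interpretations. -/
theorem interprets_unique {f : MP X ⟶ Y} {Q : Protocol Y} {y y' : Y.Word} {l : X.Word}
    (hy : Q.IsMaximal y) (hy' : Q.IsMaximal y') (h : Interprets f y l) (h' : Interprets f y' l) :
    y = y' := by
  obtain ⟨a, ha, rfl⟩ := interprets_iff.1 h
  obtain ⟨a', ha', e⟩ := interprets_iff.1 h'
  have key : Follows (act f (runsAlong a')) y := by
    intro p hp
    rw [← ha p hp]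
    refine congrArg (f.onOut p.1) (runsAlong_congr fun x hx => ?_).symm
    have hx' : (⟨x, a x⟩ : Σ x, X.Out x) ∈ interpretation f a y :=
      mem_record.2 ⟨mem_firsts.2 (List.mem_flatMap.2 ⟨p.1, List.mem_map_of_mem hp, hx⟩), rfl⟩
    rw [e] at hx'
    exact (mem_record.1 hx').2.symm
  rw [hy.eq_record_trace key, hy'.eq_record_trace ha']

theorem isExtension_ext (f : MP X ⟶ Y) : IsExtension f (ext f) := by
  intro Q
  constructor
  · ext l
    rw [Protocol.mem_runs_iff, Set.mem_ofPred_eq]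
    constructor
    · rintro ⟨a, h⟩
      refine ⟨_, (Q.isMaximal_record_trace (act f (runsAlong a))).1, _, ?_, h⟩
      rw [← interpretation_record]
      exact interprets_iff.2 ⟨a, follows_record.2 fun _ _ => rfl, rfl⟩
    · rintro ⟨y, hy, m, hm, h⟩
      obtain ⟨a, ha, rfl⟩ := interprets_iff.1 hm
      refine ⟨a, h.trans (record_prefix ?_)⟩
      rw [trace_ext]
      refine firsts_prefix ?_
      obtain ⟨n, hn⟩ := (Q.prefix_record_trace hy ha).map Sigma.fst
      rw [map_fst_record] at hn
      rw [← hn, List.flatMap_append]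
      exact List.prefix_append _ _
  · intro l
    obtain ⟨a, rfl⟩ := exists_eq_runsAlong l
    rw [interprets_iff]
    refine ⟨a, ?_⟩
    have := congrFun (act_ext f a) Q
    simp only [act] at this
    rw [this]
    exact ⟨follows_record.2 fun _ _ => rfl, (interpretation_record f Q a).symm⟩

theorem ext_eq_iff (f : MP X ⟶ Y) (g : MP X ⟶ MP Y) : ext f = g ↔ IsExtension f g := by
  constructor
  · rintro rfl
    exact isExtension_ext f
  · intro hg
    have hf := isExtension_ext f
    obtain ⟨π, h, hs⟩ := g
    obtain rfl : π = (ext f).onMeas :=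
      funext fun Q => Protocol.ext ((hg Q).1.trans (hf Q).1.symm)
    obtain rfl : h = (ext f).onOut := funext fun Q => funext fun l =>
      Subtype.ext (interprets_unique (h Q l).2 ((ext f).onOut Q l).2 ((hg Q).2 l) ((hf Q).2 l))
    rfl

end Scenario

/-! ### The comonoidal structure on scenarios -/

namespace Scenario

/-- The restriction of a global assignment on `X ⊗ Y` to `X`. -/
def leftPart {X Y : Scenario.{u}} (a : (X.tensor Y).Assignment) : X.Assignment :=
  fun x => a (Sum.inl x)

/-- The restriction of a global assignment on `X ⊗ Y` to `Y`. -/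
def rightPart {X Y : Scenario.{u}} (a : (X.tensor Y).Assignment) : Y.Assignment :=
  fun y => a (Sum.inr y)

variable {X Y Z : Scenario.{u}}

theorem assignment_tensor_ext {a b : (X.tensor Y).Assignment} (h : leftPart a = leftPart b)
    (h' : rightPart a = rightPart b) : a = b := by
  funext x
  obtain x | x := x
  exacts [congrFun h x, congrFun h' x]

theorem act_id (a : X.Assignment) : act (𝟙 X) a = a := rfl

section Parts

variable {X' Y' : Scenario.{u}} (f : X ⟶ X') (g : Y ⟶ Y') (a : (X.tensor Y).Assignment)

theorem leftPart_act_tensorMap : leftPart (act (tensorMap f g) a) = act f (leftPart a) := rfl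

theorem rightPart_act_tensorMap : rightPart (act (tensorMap f g) a) = act g (rightPart a) := rfl

variable (b : ((X.tensor Y).tensor Z).Assignment)

theorem leftPart_act_assocHom :
    leftPart (act (assocHom X Y Z) b) = leftPart (leftPart b) := rfl

theorem leftPart_rightPart_act_assocHom :
    leftPart (rightPart (act (assocHom X Y Z) b)) = rightPart (leftPart b) := rfl

theorem rightPart_rightPart_act_assocHom :
    rightPart (rightPart (act (assocHom X Y Z) b)) = rightPart b := rfl

end Parts

/-- The action of the comonad of measurement protocols on a morphism. -/
noncomputable def mapMP (f : X ⟶ Y) : MP X ⟶ MP Y := ext (counitMor X ≫ f)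

theorem trace_mapMP (f : X ⟶ Y) (Q : Protocol Y) (a : X.Assignment) :
    Protocol.trace ((mapMP f).onMeas Q) a = firsts ((Q.trace (act f a)).map f.onMeas) := by
  rw [mapMP, trace_ext, act_comp, act_counitMor]
  change firsts ((Q.trace (act f a)).flatMap
    fun y => (Protocol.single (f.onMeas y)).trace a) = _
  simp only [Protocol.trace_single]
  rw [← List.map_eq_flatMap]

theorem act_mapMP (f : X ⟶ Y) (a : X.Assignment) :
    act (mapMP f) (runsAlong a) = runsAlong (act f a) := by
  rw [mapMP, act_ext, act_comp, act_counitMor]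

theorem trace_mapMP_of_injective (f : X ⟶ Y) (hf : f.onMeas.Injective) (Q : Protocol Y)
    (a : X.Assignment) :
    Protocol.trace ((mapMP f).onMeas Q) a = (Q.trace (act f a)).map f.onMeas := by
  rw [trace_mapMP, firsts_of_nodup ((Q.nodup_trace _).map hf)]

theorem trace_inl (Q : Protocol X) (a : (X.tensor Y).Assignment) :
    (Q.inl Y).trace a = (Q.trace (leftPart a)).map Sum.inl :=
  Protocol.trace_relabel _ _ _ _ _

theorem trace_inr (Q : Protocol Y) (a : (X.tensor Y).Assignment) :
    (Q.inr X).trace a = (Q.trace (rightPart a)).map Sum.inr :=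
  Protocol.trace_relabel _ _ _ _ _

variable (X Y) in
/-- The comonoidal transformation, with its type stated in terms of `Scenario.tensor`. -/
noncomputable def splitMor : MP (X.tensor Y) ⟶ (MP X).tensor (MP Y) := comonoidalMor X Y

theorem leftPart_act_splitMor (a : (X.tensor Y).Assignment) :
    leftPart (act (splitMor X Y) (runsAlong a)) = runsAlong (leftPart a) := by
  funext Q
  have h := Classical.choose_spec (Protocol.exists_of_isMaximal_relabel
      (Z := X.tensor Y) (Scenario.inlOut X Y) Sum.inl_injective Scenario.inl_image_mem
      (runsAlong a (Q.inl Y)).2)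
  refine Subtype.ext (relabelWord_injective (Scenario.inlOut X Y) Sum.inl_injective
    (h.2.trans ?_))
  simp only [runsAlong, trace_inl, record, relabelWord, List.map_map]
  rfl

theorem rightPart_act_splitMor (a : (X.tensor Y).Assignment) :
    rightPart (act (splitMor X Y) (runsAlong a)) = runsAlong (rightPart a) := by
  funext Q
  have h := Classical.choose_spec (Protocol.exists_of_isMaximal_relabel
      (Z := X.tensor Y) (Scenario.inrOut X Y) Sum.inr_injective Scenario.inr_image_mem
      (runsAlong a (Q.inr X)).2)
  refine Subtype.ext (relabelWord_injective (Scenario.inrOut X Y) Sum.inr_injective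
    (h.2.trans ?_))
  simp only [runsAlong, trace_inr, record, relabelWord, List.map_map]
  rfl

theorem splitMor_natural {X' Y' : Scenario.{u}} (f : X ⟶ X') (g : Y ⟶ Y') :
    mapMP (tensorMap f g) ≫ splitMor X' Y' = splitMor X Y ≫ tensorMap (mapMP f) (mapMP g) := by
  refine hom_MP_ext ?_ fun a => ?_
  · rintro (Q | Q) a
    · change Protocol.trace ((mapMP (tensorMap f g)).onMeas (Q.inl Y')) a =
        Protocol.trace (Protocol.inl Y ((mapMP f).onMeas Q)) a
      rw [trace_mapMP, trace_inl, trace_inl, trace_mapMP, ← firsts_map Sum.inl_injective,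
        List.map_map, List.map_map]
      rfl
    · change Protocol.trace ((mapMP (tensorMap f g)).onMeas (Q.inr X')) a =
        Protocol.trace (Protocol.inr X ((mapMP g).onMeas Q)) a
      rw [trace_mapMP, trace_inr, trace_inr, trace_mapMP, ← firsts_map Sum.inr_injective,
        List.map_map, List.map_map]
      rfl
  · rw [act_comp, act_comp, act_mapMP]
    apply assignment_tensor_ext
    · rw [leftPart_act_splitMor, leftPart_act_tensorMap, leftPart_act_tensorMap,
        leftPart_act_splitMor, act_mapMP]
    · rw [rightPart_act_splitMor, rightPart_act_tensorMap, rightPart_act_tensorMap,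
        rightPart_act_splitMor, act_mapMP]

theorem splitMor_assoc :
    splitMor (X.tensor Y) Z ≫ tensorMap (splitMor X Y) (𝟙 (MP Z)) ≫
        assocHom (MP X) (MP Y) (MP Z) =
      mapMP (assocHom X Y Z) ≫ splitMor X (Y.tensor Z) ≫
        tensorMap (𝟙 (MP X)) (splitMor Y Z) := by
  have hi : (assocHom X Y Z).onMeas.Injective := by
    rintro (x | x | x) (y | y | y) h <;> cases h <;> rfl
  refine hom_MP_ext ?_ fun a => ?_
  · rintro (Q | Q | Q) a
    · change Protocol.trace (Protocol.inl Z (Protocol.inl Y Q)) a =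
        Protocol.trace ((mapMP (assocHom X Y Z)).onMeas (Protocol.inl (Y.tensor Z) Q)) a
      rw [trace_mapMP_of_injective _ hi, trace_inl, trace_inl, trace_inl, List.map_map,
        List.map_map]
      rfl
    · change Protocol.trace (Protocol.inl Z (Protocol.inr X Q)) a =
        Protocol.trace ((mapMP (assocHom X Y Z)).onMeas (Protocol.inr X (Protocol.inl Z Q))) a
      rw [trace_mapMP_of_injective _ hi, trace_inl, trace_inr, trace_inr, trace_inl,
        List.map_map, List.map_map, List.map_map]
      rfl
    · change Protocol.trace (Protocol.inr (X.tensor Y) Q) a =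
        Protocol.trace ((mapMP (assocHom X Y Z)).onMeas (Protocol.inr X (Protocol.inr Y Q))) a
      rw [trace_mapMP_of_injective _ hi, trace_inr, trace_inr, trace_inr, List.map_map,
        List.map_map]
      rfl
  · simp only [act_comp, act_mapMP]
    refine assignment_tensor_ext ?_ (assignment_tensor_ext ?_ ?_)
    · simp only [leftPart_act_assocHom, leftPart_act_tensorMap, leftPart_act_splitMor, act_id]
    · simp only [leftPart_rightPart_act_assocHom, leftPart_act_tensorMap,
        rightPart_act_tensorMap, leftPart_act_splitMor, rightPart_act_splitMor]
    · simp only [rightPart_rightPart_act_assocHom, rightPart_act_tensorMap,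
        rightPart_act_splitMor, act_id]

theorem hom_unit_ext (f g : X ⟶ unit) : f = g :=
  hom_ext (fun x => x.elim) (fun x => x.elim)

theorem splitMor_leftUnit : leftUnitInv (MP X) =
    mapMP (leftUnitInv X) ≫ splitMor unit X ≫ tensorMap (counitMor unit) (𝟙 (MP X)) := by
  have hi : (leftUnitInv X).onMeas.Injective := by
    rintro (⟨⟨⟩⟩ | x) (⟨⟨⟩⟩ | y) h; cases h; rfl
  refine hom_MP_ext ?_ fun a => ?_
  · rintro (⟨⟨⟩⟩ | Q) a
    change Protocol.trace Q a = Protocol.trace ((mapMP (leftUnitInv X)).onMeas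
      (Protocol.inr unit Q)) a
    rw [trace_mapMP_of_injective _ hi, trace_inr, List.map_map]
    exact (List.map_id _).symm
  · rw [act_comp, act_comp, act_mapMP]
    refine assignment_tensor_ext (funext fun x => x.elim) ?_
    rw [rightPart_act_tensorMap, rightPart_act_splitMor]
    rfl

theorem splitMor_rightUnit : rightUnitInv (MP X) =
    mapMP (rightUnitInv X) ≫ splitMor X unit ≫ tensorMap (𝟙 (MP X)) (counitMor unit) := by
  have hi : (rightUnitInv X).onMeas.Injective := by
    rintro (x | ⟨⟨⟩⟩) (y | ⟨⟨⟩⟩) h; cases h; rfl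
  refine hom_MP_ext ?_ fun a => ?_
  · rintro (Q | ⟨⟨⟩⟩) a
    change Protocol.trace Q a = Protocol.trace ((mapMP (rightUnitInv X)).onMeas
      (Protocol.inl unit Q)) a
    rw [trace_mapMP_of_injective _ hi, trace_inl, List.map_map]
    exact (List.map_id _).symm
  · rw [act_comp, act_comp, act_mapMP]
    refine assignment_tensor_ext ?_ (funext fun x => x.elim)
    rw [leftPart_act_tensorMap, leftPart_act_splitMor]
    rfl

theorem splitMor_counit :
    splitMor X Y ≫ tensorMap (counitMor X) (counitMor Y) = counitMor (X.tensor Y) := by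
  refine hom_MP_ext ?_ fun a => ?_
  · rintro (x | y) a
    · change Protocol.trace (Protocol.inl Y (Protocol.single x)) a =
        Protocol.trace (Protocol.single _) a
      rw [trace_inl, Protocol.trace_single, Protocol.trace_single]
      rfl
    · change Protocol.trace (Protocol.inr X (Protocol.single y)) a =
        Protocol.trace (Protocol.single _) a
      rw [trace_inr, Protocol.trace_single, Protocol.trace_single]
      rfl
  · rw [act_counitMor, act_comp]
    apply assignment_tensor_ext
    · rw [leftPart_act_tensorMap, leftPart_act_splitMor, act_counitMor]
    · rw [rightPart_act_tensorMap, rightPart_act_splitMor, act_counitMor]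

theorem splitMor_comul :
    ext (splitMor X Y) ≫ splitMor (MP X) (MP Y) =
      splitMor X Y ≫ tensorMap (ext (𝟙 (MP X))) (ext (𝟙 (MP Y))) := by
  refine hom_MP_ext ?_ fun a => ?_
  · rintro (Q | Q) a
    · change Protocol.trace ((ext (splitMor X Y)).onMeas (Protocol.inl (MP Y) Q)) a =
        Protocol.trace (Protocol.inl Y ((ext (𝟙 (MP X))).onMeas Q)) a
      rw [trace_ext, trace_inl, trace_inl, trace_ext, ← firsts_map Sum.inl_injective,
        List.map_flatMap, List.flatMap_map, leftPart_act_splitMor]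
      exact congrArg firsts (congrArg (fun φ => List.flatMap φ _) (funext fun P => trace_inl P a))
    · change Protocol.trace ((ext (splitMor X Y)).onMeas (Protocol.inr (MP X) Q)) a =
        Protocol.trace (Protocol.inr X ((ext (𝟙 (MP Y))).onMeas Q)) a
      rw [trace_ext, trace_inr, trace_inr, trace_ext, ← firsts_map Sum.inr_injective,
        List.map_flatMap, List.flatMap_map, rightPart_act_splitMor]
      exact congrArg firsts (congrArg (fun φ => List.flatMap φ _) (funext fun P => trace_inr P a))
  · rw [act_comp, act_comp, act_ext]
    apply assignment_tensor_ext
    · rw [leftPart_act_tensorMap, leftPart_act_splitMor, leftPart_act_splitMor,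
        act_ext, act_id]
    · rw [rightPart_act_tensorMap, rightPart_act_splitMor, rightPart_act_splitMor,
        act_ext, act_id]

end Scenario

theorem CokleisliTriple.ext_id_comp_map {C : Type v} [Category.{w} C] {T : C → C}
    (S : CokleisliTriple C T) {X Y : C} (f : T X ⟶ Y) :
    S.ext (𝟙 (T X)) ≫ S.comonad.map f = S.ext f := by
  change S.ext (𝟙 (T X)) ≫ S.ext (S.counit (T X) ≫ f) = S.ext f
  rw [← S.ext_comp, ← Category.assoc, S.ext_comp_counit, Category.id_comp]

namespace Scenario

/-- The comonad of measurement protocols on scenarios is comonoidal. -/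
noncomputable def comonoidal : ComonoidalComonad cokleisli.{u}.comonad where
  oplax :=
    { η := counitMor unit
      δ := comonoidalMor
      δ_natural_left := fun {X X'} f Y => by
        have h := splitMor_natural f (𝟙 Y)
        have e : mapMP (𝟙 Y) = 𝟙 (MP Y) := cokleisli.comonad.map_id Y
        rw [e] at h
        exact h.symm
      δ_natural_right := fun {Y Y'} X f => by
        have h := splitMor_natural (𝟙 X) f
        have e : mapMP (𝟙 X) = 𝟙 (MP X) := cokleisli.comonad.map_id X
        rw [e] at h
        exact h.symm
      oplax_associativity := fun _ _ _ => splitMor_assoc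
      oplax_left_unitality := fun _ => splitMor_leftUnit
      oplax_right_unitality := fun _ => splitMor_rightUnit }
  counit_tensor _ _ := splitMor_counit
  counit_unit := rfl
  comul_tensor X Y := by
    rw [← Category.assoc]
    exact (congrArg (· ≫ splitMor (MP X) (MP Y))
      (cokleisli.ext_id_comp_map (splitMor X Y))).trans splitMor_comul
  comul_unit := hom_unit_ext _ _

end Scenario

/-! ### Expectations over finite distributions -/

namespace PMF

variable {α β : Type*} [Finite α] [Finite β]

/-- The expectation of real functions under a probability distribution on a finite type, as a linear
functional. -/
noncomputable def expect (p : PMF α) : (α → ℝ) →ₗ[ℝ] ℝ :=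
  letI := Fintype.ofFinite α
  ∑ s, (p s).toReal • LinearMap.proj s

theorem expect_apply [Fintype α] (p : PMF α) (φ : α → ℝ) :
    p.expect φ = ∑ s, (p s).toReal * φ s := by
  rw [expect, LinearMap.sum_apply]
  simp only [LinearMap.smul_apply, LinearMap.proj_apply, smul_eq_mul]
  congr!

theorem expect_pure (a : α) (φ : α → ℝ) : (PMF.pure a).expect φ = φ a := by
  classical
  have := Fintype.ofFinite α
  rw [expect_apply, Finset.sum_eq_single a]
  · simp
  · intro b _ hb
    simp [PMF.pure_apply, hb]
  · simp

theorem expect_bind (p : PMF α) (q : α → PMF β) (φ : β → ℝ) :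
    (p.bind q).expect φ = p.expect fun a => (q a).expect φ := by
  have := Fintype.ofFinite α
  have := Fintype.ofFinite β
  have h : ∀ b, ((p.bind q) b).toReal = ∑ a, (p a).toReal * (q a b).toReal := by
    intro b
    rw [PMF.bind_apply, tsum_fintype, ENNReal.toReal_sum]
    · simp only [ENNReal.toReal_mul]
    · exact fun a _ => ENNReal.mul_ne_top (p.apply_ne_top a) ((q a).apply_ne_top b)
  simp only [expect_apply, h, Finset.sum_mul, Finset.mul_sum]
  rw [Finset.sum_comm]
  simp only [mul_assoc]

theorem expect_map (p : PMF α) (f : α → β) (φ : β → ℝ) :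
    (p.map f).expect φ = p.expect fun a => φ (f a) := by
  change (p.bind (PMF.pure ∘ f)).expect φ = _
  rw [expect_bind]
  simp only [Function.comp, expect_pure]

open Classical in
theorem expect_indicator (p : PMF α) (a : α) :
    p.expect (fun b => if b = a then 1 else 0) = (p a).toReal := by
  have := Fintype.ofFinite α
  simp [expect_apply]

theorem expect_one (p : PMF α) : p.expect (fun _ => 1) = 1 := by
  have := Fintype.ofFinite α
  have h := p.tsum_coe
  rw [tsum_fintype] at h
  simp only [expect_apply, mul_one]
  rw [← ENNReal.toReal_sum fun a _ => p.apply_ne_top a, h, ENNReal.toReal_one]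

theorem eq_of_expect {p q : PMF α} (h : ∀ φ, p.expect φ = q.expect φ) : p = q := by
  classical
  ext a
  have := h fun b => if b = a then 1 else 0
  rwa [expect_indicator, expect_indicator,
    ENNReal.toReal_eq_toReal_iff' (p.apply_ne_top a) (q.apply_ne_top a)] at this

end PMF

instance {X : Scenario.{u}} (Q : Protocol X) : Finite {l : X.Word // Q.IsMaximal l} :=
  (MP X).finite_out Q

instance {X Y : Scenario.{u}} (x : X.Meas ⊕ Y.Meas) : Finite (Sum.elim X.Out Y.Out x) :=
  (X.tensor Y).finite_out x

/-! ### Signed global sections of empirical models -/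

namespace EmpiricalModel

variable {X Y : Scenario.{u}}

/-- The restriction of a global assignment to a set of measurements. -/
def restrictTo (a : X.Assignment) (U : Set X.Meas) : X.Sections U := fun x => a x

/-- `I` is the integral against a signed measure on global assignments whose marginals are the
distributions of the empirical model `e`. -/
def IsGlobal (e : EmpiricalModel X) (I : (X.Assignment → ℝ) →ₗ[ℝ] ℝ) : Prop :=
  ∀ (σ : X.faces) (φ : X.Sections σ.1 → ℝ),
    I (fun a => φ (restrictTo a σ.1)) = (e.prob σ).expect φ

/-- An empirical model is determined by any of its signed global sections. -/
theorem IsGlobal.model_eq {d e : EmpiricalModel X} {I : (X.Assignment → ℝ) →ₗ[ℝ] ℝ}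
    (hd : d.IsGlobal I) (he : e.IsGlobal I) : d = e :=
  ext_prob fun σ => PMF.eq_of_expect fun φ => (hd σ φ).symm.trans (he σ φ)

theorem IsGlobal.apply_one {e : EmpiricalModel X} {I : (X.Assignment → ℝ) →ₗ[ℝ] ℝ}
    (he : e.IsGlobal I) : I (fun _ => 1) = 1 :=
  (he ⟨∅, X.empty_mem⟩ fun _ => 1).trans (PMF.expect_one _)

theorem IsGlobal.pushforward {d : EmpiricalModel X} {I : (X.Assignment → ℝ) →ₗ[ℝ] ℝ}
    (hd : d.IsGlobal I) (f : X ⟶ Y) :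
    (pushforward f d).IsGlobal (I ∘ₗ LinearMap.funLeft ℝ ℝ (act f)) := by
  intro σ φ
  refine Eq.trans ?_ (PMF.expect_map _ _ _).symm
  rw [← hd]
  rfl

section Existence

open Classical in
/-- Extend an assignment on `U` to a global one, using the outcomes of `c` outside `U`. -/
noncomputable def fillIn (c : X.Assignment) {U : Set X.Meas} (s : X.Sections U) : X.Assignment :=
  fun x => if h : x ∈ U then s ⟨x, h⟩ else c x

theorem fillIn_of_mem {c : X.Assignment} {U : Set X.Meas} {s : X.Sections U} {x : X.Meas}
    (h : x ∈ U) : fillIn c s x = s ⟨x, h⟩ := dif_pos h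

theorem fillIn_of_notMem {c : X.Assignment} {U : Set X.Meas} {s : X.Sections U} {x : X.Meas}
    (h : x ∉ U) : fillIn c s x = c x := dif_neg h

/-- The expectation with the measurements in `σ` distributed as in the model, and the outcomes of
all others fixed to be those of `c`. -/
noncomputable def expectAt (e : EmpiricalModel X) (c : X.Assignment) (σ : X.faces) :
    (X.Assignment → ℝ) →ₗ[ℝ] ℝ :=
  (e.prob σ).expect ∘ₗ LinearMap.funLeft ℝ ℝ (fillIn c)

/-- By compatibility of the marginals, the expectation of a function that depends only on the
measurements in a context may be computed in any larger context. -/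
theorem expectAt_eq_of_subset (e : EmpiricalModel X) (c : X.Assignment) {τ σ : X.faces}
    (h : τ.1 ⊆ σ.1) {φ : X.Assignment → ℝ} (hφ : DependsOn φ τ.1) :
    e.expectAt c σ φ = e.expectAt c τ φ := by
  change (e.prob σ).expect (fun s => φ (fillIn c s)) = (e.prob τ).expect fun s => φ (fillIn c s)
  rw [← e.compat σ τ h, PMF.expect_map]
  congr 1
  funext s
  refine hφ fun x hx => ?_
  rw [fillIn_of_mem hx, fillIn_of_mem (h hx)]
  rfl

/-- Every empirical model has a signed global section. Contexts are added one by one to those whose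
marginals are right. If `I` is right below the contexts that have been treated so far, and `A` is
the operator that fixes the outcomes outside the new context `ρ`, then `I + E_ρ - I ∘ A` is right
below `ρ` as well. -/
theorem exists_isGlobal (e : EmpiricalModel X) : ∃ I, e.IsGlobal I := by
  classical
  have := Fintype.ofFinite X.faces
  let c : X.Assignment := fun x => (X.nonempty_out x).some
  have key : ∀ S : Finset X.faces, ∃ I : (X.Assignment → ℝ) →ₗ[ℝ] ℝ, ∀ τ : X.faces,
      (∃ ρ ∈ S, τ.1 ⊆ ρ.1) → ∀ φ, DependsOn φ τ.1 → I φ = e.expectAt c τ φ := by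
    intro S
    induction S using Finset.induction_on with
    | empty => exact ⟨0, by simp⟩
    | insert ρ S _ ih =>
      obtain ⟨I, hI⟩ := ih
      let A := LinearMap.funLeft ℝ ℝ fun a : X.Assignment => fillIn c (restrictTo a ρ.1)
      refine ⟨I + e.expectAt c ρ - I ∘ₗ A, fun τ hτ φ hφ => ?_⟩
      rw [LinearMap.sub_apply, LinearMap.add_apply, LinearMap.comp_apply]
      obtain ⟨ρ', hρ', hτ⟩ := hτ
      obtain rfl | hρ' := Finset.mem_insert.1 hρ'
      · have hA : A φ = φ := by
          funext a
          exact hφ fun x hx => fillIn_of_mem (hτ hx)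
        rw [hA, expectAt_eq_of_subset e c hτ hφ]
        ring
      · -- `A φ` depends only on `ρ ∩ τ`, and it has the same expectation at `ρ` as `φ`
        have hm : ρ.1 ∩ τ.1 ∈ X.faces := X.down_closed _ τ.2 _ Set.inter_subset_right
        have hA : DependsOn (A φ) (ρ.1 ∩ τ.1) := by
          intro a b hab
          refine hφ fun x hx => ?_
          change fillIn c (restrictTo a ρ.1) x = fillIn c (restrictTo b ρ.1) x
          by_cases hxρ : x ∈ ρ.1
          · rw [fillIn_of_mem hxρ, fillIn_of_mem hxρ]
            exact hab x ⟨hxρ, hx⟩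
          · rw [fillIn_of_notMem hxρ, fillIn_of_notMem hxρ]
        have h1 : e.expectAt c ρ (A φ) = e.expectAt c ρ φ := by
          refine congrArg (e.prob ρ).expect (funext fun s => congrArg φ ?_)
          refine congrArg (fillIn c) (funext fun x => ?_)
          exact fillIn_of_mem x.2
        rw [hI τ ⟨ρ', hρ', hτ⟩ φ hφ,
          hI ⟨_, hm⟩ ⟨ρ', hρ', Set.inter_subset_right.trans hτ⟩ _ hA,
          ← expectAt_eq_of_subset e c (τ := ⟨_, hm⟩) (σ := ρ) Set.inter_subset_left hA, h1]
        ring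
  obtain ⟨I, hI⟩ := key Finset.univ
  refine ⟨I, fun σ φ => ?_⟩
  refine (hI σ ⟨σ, Finset.mem_univ _, subset_rfl⟩ (fun a => φ (restrictTo a σ.1)) fun a b h =>
    congrArg φ (funext fun x => h x x.2)).trans ?_
  refine congrArg (e.prob σ).expect (funext fun s => congrArg φ (funext fun x => ?_))
  exact fillIn_of_mem x.2

end Existence

/-! ### The models `MP(e)` -/

open Classical in
/-- The global assignments along which the runs `s` occur form a cylinder: they are the ones that
extend the joint assignment of `s`, and there are none if the runs are not consistent. -/
theorem toReal_mpProb {e : EmpiricalModel X} {I : (X.Assignment → ℝ) →ₗ[ℝ] ℝ} (he : e.IsGlobal I)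
    (σ : (MP X).faces) (s : (MP X).Sections σ.1) : (mpProb e σ s).toReal =
      I fun a => if restrictTo (runsAlong a) σ.1 = s then 1 else 0 := by
  have hspec : ∀ x, ∃ Q, (⟨x.1, jointAssignment s x⟩ : Σ x, X.Out x) ∈ (s Q).1 :=
    fun x => Classical.choose_spec
      (p := fun o : X.Out x.1 => ∃ Q, (⟨x.1, o⟩ : Σ x, X.Out x) ∈ (s Q).1) (by
        obtain ⟨Q, hQ⟩ := Set.mem_iUnion.1 x.2
        obtain ⟨⟨_, o⟩, ho, hx⟩ := List.mem_map.1 hQ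
        obtain ⟨x, _⟩ := x
        cases hx
        exact ⟨o, Q, ho⟩)
  rw [mpProb]
  split_ifs with h
  · rw [← PMF.expect_indicator, ← he]
    congr 1
    funext a
    congr 1
    refine propext ⟨fun ha => funext fun Q => ?_, fun ha => funext fun x => ?_⟩
    · refine (Subtype.ext ((s Q).2.eq_record_trace fun p hp => ?_)).symm
      have hx : p.1 ∈ ⋃ Q, (s Q).1.support :=
        Set.mem_iUnion.2 ⟨Q, List.mem_map_of_mem hp⟩
      obtain ⟨Q', hQ'⟩ := hspec ⟨p.1, hx⟩
      exact (congrFun ha ⟨p.1, hx⟩).trans (h Q' Q _ _ _ hQ' hp)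
    · obtain ⟨Q, hQ⟩ := hspec x
      have hQ' : (⟨x.1, jointAssignment s x⟩ : Σ x, X.Out x) ∈
          (restrictTo (runsAlong a) σ.1 Q).1 := by
        rwa [congrFun ha Q]
      exact (mem_record.1 hQ').2
  · have h0 : (fun a : X.Assignment =>
        if restrictTo (runsAlong a) σ.1 = s then (1 : ℝ) else 0) = 0 := by
      funext a
      refine if_neg ?_
      rintro rfl
      exact h fun Q Q' => (follows_record.2 fun _ _ => rfl : Follows a _).consistent
        (follows_record.2 fun _ _ => rfl)
    rw [h0, map_zero, ENNReal.toReal_zero]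

theorem mpProb_ne_top (e : EmpiricalModel X) (σ : (MP X).faces) (s : (MP X).Sections σ.1) :
    mpProb e σ s ≠ ⊤ := by
  rw [mpProb]
  split_ifs
  · exact PMF.apply_ne_top _ _
  · exact ENNReal.zero_ne_top

theorem sum_mpProb (e : EmpiricalModel X) (σ : (MP X).faces) [Fintype ((MP X).Sections σ.1)] :
    ∑ s, mpProb e σ s = 1 := by
  classical
  obtain ⟨I, hI⟩ := e.exists_isGlobal
  rw [← ENNReal.toReal_eq_one_iff, ENNReal.toReal_sum fun s _ => mpProb_ne_top e σ s]
  simp only [toReal_mpProb hI]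
  rw [← map_sum]
  refine Eq.trans ?_ hI.apply_one
  congr 1
  funext a
  simp

/-- The distribution of the runs of a compatible set of protocols. -/
noncomputable def mpPMF (e : EmpiricalModel X) (σ : (MP X).faces) : PMF ((MP X).Sections σ.1) :=
  letI := Fintype.ofFinite ((MP X).Sections σ.1)
  PMF.ofFintype (mpProb e σ) (sum_mpProb e σ)

theorem expect_mpPMF {e : EmpiricalModel X} {I : (X.Assignment → ℝ) →ₗ[ℝ] ℝ} (he : e.IsGlobal I)
    (σ : (MP X).faces) (φ : (MP X).Sections σ.1 → ℝ) :
    (mpPMF e σ).expect φ = I fun a => φ (restrictTo (runsAlong a) σ.1) := by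
  classical
  have := Fintype.ofFinite ((MP X).Sections σ.1)
  have h : ∀ s, mpPMF e σ s = mpProb e σ s := fun _ => rfl
  rw [PMF.expect_apply]
  simp only [h, toReal_mpProb he]
  have hs : ∀ (r : ℝ) (ψ : X.Assignment → ℝ), I ψ * r = I (r • ψ) := fun r ψ => by
    rw [map_smul, smul_eq_mul, mul_comm]
  simp only [hs]
  rw [← map_sum]
  congr 1
  funext a
  simp

/-- The empirical model `MP(e)` on the scenario of measurement protocols. -/
noncomputable def mp (e : EmpiricalModel X) : EmpiricalModel (MP X) where
  prob := mpPMF e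
  compat σ τ h := by
    obtain ⟨I, hI⟩ := e.exists_isGlobal
    refine PMF.eq_of_expect fun φ => ?_
    rw [PMF.expect_map, expect_mpPMF hI, expect_mpPMF hI]
    rfl

theorem IsGlobal.mp {e : EmpiricalModel X} {I : (X.Assignment → ℝ) →ₗ[ℝ] ℝ} (he : e.IsGlobal I) :
    e.mp.IsGlobal (I ∘ₗ LinearMap.funLeft ℝ ℝ runsAlong) :=
  fun σ φ => (expect_mpPMF he σ φ).symm

/-! ### The structure maps are simulations -/

theorem pushforward_counitMor (e : EmpiricalModel X) : pushforward (counitMor X) e.mp = e := by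
  obtain ⟨I, hI⟩ := e.exists_isGlobal
  refine (hI.mp.pushforward (counitMor X)).model_eq fun σ φ => ?_
  rw [← hI]
  simp only [LinearMap.comp_apply]
  congr 1
  funext a
  simp only [LinearMap.funLeft_apply, act_counitMor]

theorem pushforward_ext (f : MP X ⟶ Y) (d : EmpiricalModel X) :
    pushforward (ext f) d.mp = (pushforward f d.mp).mp := by
  obtain ⟨I, hI⟩ := d.exists_isGlobal
  have h1 := hI.mp.pushforward (ext f)
  have h2 := (hI.mp.pushforward f).mp
  refine h1.model_eq ?_
  convert h2 using 1
  ext φ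
  simp only [LinearMap.comp_apply]
  congr 1
  funext a
  simp only [LinearMap.funLeft_apply, act_ext]

/-- Combine global assignments on `X` and `Y` into one on `X ⊗ Y`. -/
def pair (a : X.Assignment) (b : Y.Assignment) : (X.tensor Y).Assignment :=
  fun z => match z with
    | Sum.inl x => a x
    | Sum.inr y => b y

/-- The functional on global assignments on `X ⊗ Y` that applies `J` in the second and `I` in the
first argument. -/
def pairFunctional (I : (X.Assignment → ℝ) →ₗ[ℝ] ℝ) (J : (Y.Assignment → ℝ) →ₗ[ℝ] ℝ) :
    ((X.tensor Y).Assignment → ℝ) →ₗ[ℝ] ℝ where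
  toFun φ := I fun a => J fun b => φ (pair a b)
  map_add' φ ψ := by
    rw [← map_add]
    congr 1
    funext a
    exact map_add J _ _
  map_smul' r φ := by
    rw [RingHom.id_apply, ← map_smul]
    congr 1
    funext a
    exact map_smul J _ _

theorem IsGlobal.tensor {d : EmpiricalModel X} {e : EmpiricalModel Y}
    {I : (X.Assignment → ℝ) →ₗ[ℝ] ℝ} {J : (Y.Assignment → ℝ) →ₗ[ℝ] ℝ} (hd : d.IsGlobal I)
    (he : e.IsGlobal J) : (d.tensor e).IsGlobal (pairFunctional I J) := by
  intro σ φ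
  have h : ∀ (a : X.Assignment) (b : Y.Assignment), restrictTo (pair a b) σ.1 =
      join σ.1 (restrictTo a _) (restrictTo b _) := by
    intro a b
    funext x
    obtain ⟨x | x, hx⟩ := x <;> rfl
  refine Eq.trans ?_ (PMF.expect_bind _ _ _).symm
  change (I fun a => J fun b => φ (restrictTo (pair a b) σ.1)) = _
  simp only [h, PMF.expect_map]
  rw [← hd]
  congr 1
  funext a
  exact he ⟨_, σ.2.2⟩ fun t => φ (join σ.1 (restrictTo a _) t)

theorem pushforward_splitMor (d : EmpiricalModel X) (e : EmpiricalModel Y) :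
    pushforward (splitMor X Y) (d.tensor e).mp = d.mp.tensor e.mp := by
  obtain ⟨I, hI⟩ := d.exists_isGlobal
  obtain ⟨J, hJ⟩ := e.exists_isGlobal
  refine ((hI.tensor hJ).mp.pushforward (splitMor X Y)).model_eq ?_
  convert hI.mp.tensor hJ.mp using 1
  ext φ
  have h : ∀ (a : X.Assignment) (b : Y.Assignment),
      act (splitMor X Y) (runsAlong (pair a b)) = pair (runsAlong a) (runsAlong b) := by
    intro a b
    apply assignment_tensor_ext
    · rw [leftPart_act_splitMor]
      rfl
    · rw [rightPart_act_splitMor]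
      rfl
  change (I fun a => J fun b => φ (act (splitMor X Y) (runsAlong (pair a b)))) = _
  simp only [h]
  rfl

end EmpiricalModel

/-! ### The comonad on empirical models -/

namespace Emp

/-- The measurement protocols over an empirical model, as an object of `Emp`. -/
noncomputable abbrev mp (e : Emp.{u}) : Emp.{u} := ⟨MP e.scenario, e.model.mp⟩

/-- The co-Kleisli triple of measurement protocols on empirical models. -/
noncomputable def cokleisli : CokleisliTriple Emp.{u} mp where
  counit e := ⟨counitMor e.scenario, (EmpiricalModel.pushforward_counitMor e.model).symm⟩
  ext {d e} f := ⟨ext f.mor, by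
    rw [EmpiricalModel.pushforward_ext, ← f.sim]⟩
  ext_counit e := hom_ext (Scenario.cokleisli.ext_counit e.scenario)
  ext_comp_counit f := hom_ext (Scenario.cokleisli.ext_comp_counit f.mor)
  ext_comp f g := hom_ext (Scenario.cokleisli.ext_comp f.mor g.mor)

/-- The comonad of measurement protocols on empirical models is comonoidal. -/
noncomputable def comonoidal : ComonoidalComonad cokleisli.{u}.comonad where
  oplax :=
    { η := cokleisli.counit zero
      δ := fun d e => ⟨comonoidalMor d.scenario e.scenario,
        (EmpiricalModel.pushforward_splitMor d.model e.model).symm⟩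
      δ_natural_left := fun f e =>
        hom_ext (Scenario.comonoidal.oplax.δ_natural_left f.mor e.scenario)
      δ_natural_right := fun d f =>
        hom_ext (Scenario.comonoidal.oplax.δ_natural_right d.scenario f.mor)
      oplax_associativity := fun c d e => hom_ext
        (Scenario.comonoidal.oplax.oplax_associativity c.scenario d.scenario e.scenario)
      oplax_left_unitality := fun d =>
        hom_ext (Scenario.comonoidal.oplax.oplax_left_unitality d.scenario)
      oplax_right_unitality := fun d =>
        hom_ext (Scenario.comonoidal.oplax.oplax_right_unitality d.scenario) }
  counit_tensor d e := hom_ext (Scenario.comonoidal.counit_tensor d.scenario e.scenario)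
  counit_unit := rfl
  comul_tensor d e := hom_ext (Scenario.comonoidal.comul_tensor d.scenario e.scenario)
  comul_unit := hom_ext (hom_unit_ext _ _)

end Emp

theorem mainTheorem2 :
    -- `MP` is a comonoidal comonad on scenarios, given as a co-Kleisli triple
    ∃ (S : CokleisliTriple Scenario.{u} MP) (mS : ComonoidalComonad S.comonad),
      (∀ X, S.counit X = counitMor X) ∧
      (∀ (X Y : Scenario.{u}) (f : MP X ⟶ Y) (g : MP X ⟶ MP Y), S.ext f = g ↔ IsExtension f g) ∧
      (∀ X Y : Scenario.{u}, mS.oplax.δ X Y = comonoidalMor X Y) ∧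
      -- the models `MP(e)` exist, and `MP` lifts to a comonoidal comonad on `Emp`
      ∃ M : ∀ {X : Scenario.{u}}, EmpiricalModel X → EmpiricalModel (MP X),
        (∀ (X : Scenario.{u}) (e : EmpiricalModel X) (σ : (MP X).faces)
          (s : (MP X).Sections σ.1), (M e).prob σ s = mpProb e σ s) ∧
        ∃ (E : CokleisliTriple Emp.{u} fun e => ⟨MP e.scenario, M e.model⟩)
          (mE : ComonoidalComonad E.comonad),
          (∀ e, (E.counit e).mor = S.counit e.scenario) ∧
          (∀ (d e : Emp.{u}) (f : (⟨MP d.scenario, M d.model⟩ : Emp.{u}) ⟶ e),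
            (E.ext f).mor = S.ext f.mor) ∧
          (∀ d e : Emp.{u}, (mE.oplax.δ d e).mor = mS.oplax.δ d.scenario e.scenario) ∧
          mE.oplax.η.mor = mS.oplax.η :=
  ⟨Scenario.cokleisli, Scenario.comonoidal, fun _ => rfl, fun _ _ f g => ext_eq_iff f g,
    fun _ _ => rfl, EmpiricalModel.mp, fun _ _ _ _ => rfl, Emp.cokleisli, Emp.comonoidal,
    fun _ => rfl, fun _ _ _ => rfl, fun _ _ => rfl, rfl⟩
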